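/- Conventions. A \emph{ranking function} $r$ maps every matrix $M\in\mathbb{Q}^{n\times m}$ (for all $n,m\ge 0$) to a permutation $r(M)$ of its $n$ rows, where $r(M)(i)$ is the position of row $i$. For each of the following rankings, ties are broken by the row index: $r_{\mathrm{Max}}^{\mathrm{asc}}$ and $r_{\mathrm{Max}}^{\mathrm{dsc}}$ rank the rows by increasing, respectively decreasing, maximum entry; $r_{\mathrm{Lex}}$ ranks them by the left-to-right lexicographic order (smaller entries first); $r_{\mathrm{Sum}}$ ranks them by increasing sum of entries. (If $m=0$, all rows are tied.) An \emph{effect function} $e$ assigns a rational number $e(a;\pi_0,\pi)$ to every original order $\pi_0$ and every order $\pi$ of the same $n$ rows, where $a$ is a finite list of natural numbers holding the additional parameters of the effect, if any (such as the number of a row of interest, or the $k$ of a top-$k$ effect). For a weight vector $u\in\mathbb{Q}^m$, $M\circ u$ is the matrix obtained from $M$ by multiplying its $j$-th column by $u_j$, for all $j$. The problem $\mathrm{EXP}\langle r,e\rangle$, for a fixed ranking function $r$ and a fixed effect function $e$, is: given a matrix $M\in\mathbb{Q}^{n\times m}$, finite probability distributions $\Pi_1,\dots,\Pi_m$ on $\mathbb{Q}$,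 each as a list of value-probability pairs, and the parameters $a$ of $e$, compute $$\mathbb{E}_{u\sim\Pi_1\times\cdots\times\Pi_m}\bigl[e(a;\, r(M),\, r(M\circ u))\bigr].$$ Rational numbers are given and returned as pairs of integers in binary, numerator and nonzero denominator, not necessarily in lowest terms. Natural numbers in $a$ are given in binary. Polynomial time is measured in the size of the encoding of the input. Theorem. \begin{enumerate} \item For every ranking function $r$ and every effect function $e$ that are computable in polynomial time, and every constant $c$, the problem $\mathrm{EXP}\langle r,e\rangle$ restricted to matrices with at most $c$ columns is solvable in polynomial time. \item For every effect function $e$ that is computable in polynomial time, and every constant $c$, the following problems, restricted to matrices with at most $c$ rows, are solvable in polynomial time: \begin{enumerate} \item $\mathrm{EXP}\langle r,e\rangle$ for each $r\in\{r_{\mathrm{Max}}^{\mathrm{asc}},\, r_{\mathrm{Max}}^{\mathrm{dsc}},\, r_{\mathrm{Lex}}\}$; \item $\mathrm{EXP}\langle r_{\mathrm{Sum}},e\rangle$, if the entries of $M$ and the values (weights) in $\Pi_1,\dots,\Pi_m$ are integers encoded in unary (the probabilities remaining fractions in binary). \end{enumerate} \end{enumerate} -/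

import Mathlib

/-! Expected effect of random column weights on a ranking: machine model, encodings, problem. -/

namespace ExpEffect

/-! ### Machine model: while-programs over binary trees, with a cost semantics -/

/-- The data of the machine model: finite binary trees. -/
inductive Data : Type where
  | leaf : Data
  | node : Data → Data → Data

/-- The number of nodes (leaves included) of a tree; the length of its description. -/
def Data.size : Data → ℕ
  | .leaf => 1
  | .node a b => a.size + b.size + 1

/-- First component of a tree (`leaf` if there is none). -/
def Data.fst : Data → Data
  | .leaf => .leaf
  | .node a _ => a

/-- Second component of a tree (`leaf` if there is none). -/
def Data.snd : Data → Data
  | .leaf => .leaf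
  | .node _ b => b

/-- Programs. Each program transforms one tree into one tree (or diverges). A test is
considered false if it returns `leaf`, and true otherwise. -/
inductive Prog : Type where
  /-- return the input -/
  | skip : Prog
  /-- return `leaf` -/
  | nil : Prog
  /-- return the first component of the input -/
  | fst : Prog
  /-- return the second component of the input -/
  | snd : Prog
  /-- run both programs on the input and return the pair of the results -/
  | pair : Prog → Prog → Prog
  /-- run the first program on the input, and the second one on its result -/
  | seq : Prog → Prog → Prog
  /-- `cond c p q`: if the test `c` is true on the input run `p` on it, otherwise run `q` on it -/
  | cond : Prog → Prog → Prog → Prog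
  /-- `loop c p`: while the test `c` is true on the current tree, replace it by the result
  of `p` on it -/
  | loop : Prog → Prog → Prog

/-- `Eval p x y t`: the program `p`, started on the tree `x`, halts with the result `y` after
`t` steps. Every single instruction costs the size of the whole tree that it is applied to
(so copying data is paid for in full), in addition to the cost of its subprograms. -/
inductive Eval : Prog → Data → Data → ℕ → Prop where
  | skip (x : Data) : Eval .skip x x x.size
  | nil (x : Data) : Eval .nil x .leaf x.size
  | fst (x : Data) : Eval .fst x x.fst x.size
  | snd (x : Data) : Eval .snd x x.snd x.size
  | pair {p q : Prog} {x y z : Data} {s t : ℕ} :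
      Eval p x y s → Eval q x z t → Eval (.pair p q) x (.node y z) (x.size + s + t)
  | seq {p q : Prog} {x y z : Data} {s t : ℕ} :
      Eval p x y s → Eval q y z t → Eval (.seq p q) x z (x.size + s + t)
  | condTrue {c p q : Prog} {x a b y : Data} {s t : ℕ} :
      Eval c x (.node a b) s → Eval p x y t → Eval (.cond c p q) x y (x.size + s + t)
  | condFalse {c p q : Prog} {x y : Data} {s t : ℕ} :
      Eval c x .leaf s → Eval q x y t → Eval (.cond c p q) x y (x.size + s + t)
  | loopDone {c p : Prog} {x : Data} {s : ℕ} :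
      Eval c x .leaf s → Eval (.loop c p) x x (x.size + s)
  | loopStep {c p : Prog} {x a b y z : Data} {s t u : ℕ} :
      Eval c x (.node a b) s → Eval p x y t → Eval (.loop c p) y z u →
      Eval (.loop c p) x z (x.size + s + t + u)

/-- The semantics is deterministic: result and running time are determined by the input. -/
theorem Eval.deterministic {p : Prog} {x y y' : Data} {t t' : ℕ}
    (h : Eval p x y t) (h' : Eval p x y' t') : y = y' ∧ t = t' := by
  induction h generalizing y' t' with
  | skip | nil | fst | snd => cases h'; exact ⟨rfl, rfl⟩
  | pair _ _ ih₁ ih₂ =>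
    cases h' with
    | pair g₁ g₂ =>
      obtain ⟨rfl, rfl⟩ := ih₁ g₁; obtain ⟨rfl, rfl⟩ := ih₂ g₂; exact ⟨rfl, rfl⟩
  | seq _ _ ih₁ ih₂ =>
    cases h' with
    | seq g₁ g₂ =>
      obtain ⟨rfl, rfl⟩ := ih₁ g₁; obtain ⟨rfl, rfl⟩ := ih₂ g₂; exact ⟨rfl, rfl⟩
  | condTrue _ _ ih₁ ih₂ =>
    cases h' with
    | condTrue g₁ g₂ =>
      obtain ⟨_, rfl⟩ := ih₁ g₁; obtain ⟨rfl, rfl⟩ := ih₂ g₂; exact ⟨rfl, rfl⟩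
    | condFalse g₁ _ => exact absurd (ih₁ g₁).1 (by simp)
  | condFalse _ _ ih₁ ih₂ =>
    cases h' with
    | condTrue g₁ _ => exact absurd (ih₁ g₁).1 (by simp)
    | condFalse g₁ g₂ =>
      obtain ⟨_, rfl⟩ := ih₁ g₁; obtain ⟨rfl, rfl⟩ := ih₂ g₂; exact ⟨rfl, rfl⟩
  | loopDone _ ih =>
    cases h' with
    | loopDone g => obtain ⟨_, rfl⟩ := ih g; exact ⟨rfl, rfl⟩
    | loopStep g _ _ => exact absurd (ih g).1 (by simp)
  | loopStep _ _ _ ih₁ ih₂ ih₃ =>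
    cases h' with
    | loopDone g => exact absurd (ih₁ g).1 (by simp)
    | loopStep g₁ g₂ g₃ =>
      obtain ⟨_, rfl⟩ := ih₁ g₁; obtain ⟨rfl, rfl⟩ := ih₂ g₂
      obtain ⟨rfl, rfl⟩ := ih₃ g₃; exact ⟨rfl, rfl⟩

/-- `RunsIn p b x y`: on input `x`, the program `p` halts with the result `y` after at most
`b(|x|)` steps, where `|x|` is the size of the input. -/
def RunsIn (p : Prog) (b : Polynomial ℕ) (x y : Data) : Prop :=
  ∃ t : ℕ, Eval p x y t ∧ t ≤ b.eval x.size

/-! ### Encodings -/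

/-- Encoding of a truth value. -/
def encBool : Bool → Data
  | false => .leaf
  | true => .node .leaf .leaf

/-- Encoding of a list, given an encoding of its entries. -/
def encList {α : Type} (f : α → Data) : List α → Data
  | [] => .leaf
  | x :: l => .node (f x) (encList f l)

/-- Encoding of a vector, as the list of its entries. -/
def encVec {α : Type} (f : α → Data) {n : ℕ} (v : Fin n → α) : Data :=
  encList f (List.ofFn v)

/-- Encoding of a matrix, as the list of its rows. -/
def encMatrix {α : Type} (f : α → Data) {n m : ℕ} (M : Matrix (Fin n) (Fin m) α) : Data :=
  encVec (encVec f) M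

/-- Binary encoding of a natural number: the list of its binary digits. -/
def encNat (k : ℕ) : Data := encList encBool k.bits

/-- Binary encoding of an integer: sign and binary digits of the absolute value. -/
def encInt (z : ℤ) : Data := .node (encBool (decide (z < 0))) (encNat z.natAbs)

/-- Unary encoding of an integer `z`: sign and a string of length `|z|`. -/
def encUnaryInt (z : ℤ) : Data :=
  .node (encBool (decide (z < 0))) (encList encBool (List.replicate z.natAbs false))

/-- Encoding of a permutation, as the list of its values in binary. -/
def encPerm {n : ℕ} (π : Equiv.Perm (Fin n)) : Data := encVec (fun i : Fin n => encNat i) π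

/-- A representation `num / den` of a rational number by two integers, not necessarily in
lowest terms. -/
structure Frac : Type where
  num : ℤ
  den : ℤ
  den_ne_zero : den ≠ 0

/-- The rational number represented by a fraction. -/
def Frac.val (q : Frac) : ℚ := (q.num : ℚ) / (q.den : ℚ)

/-- Encoding of a fraction as a pair of integers in binary. -/
def encFrac (q : Frac) : Data := .node (encInt q.num) (encInt q.den)

/-- A number format: a type of representations, the numbers they stand for, their encoding. -/
structure Format : Type 1 where
  Rep : Type
  val : Rep → ℚ
  enc : Rep → Data

/-- Rational numbers, each given by a pair of integers in binary. -/
def binaryRat : Format := ⟨Frac, Frac.val, encFrac⟩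

/-- Integers, given in unary. -/
def unaryInt : Format := ⟨ℤ, fun z => (z : ℚ), encUnaryInt⟩

/-! ### Ranking functions and effect functions -/

/-- A ranking function maps each matrix with `n` rows to a permutation `π` of the rows;
`π i` is the position of the row `i` (rows and positions are counted from `0`). -/
abbrev Ranking : Type :=
  ∀ n m : ℕ, Matrix (Fin n) (Fin m) ℚ → Equiv.Perm (Fin n)

/-- An effect function: `e n a π₀ π` is the effect of obtaining the order `π` in place of the
original order `π₀`. The list `a` holds the additional numerical parameters of the effect, if it
has any, such as the number of a row of interest and the `k` of a top-`k` effect. -/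
abbrev Effect : Type :=
  ∀ n : ℕ, List ℕ → Equiv.Perm (Fin n) → Equiv.Perm (Fin n) → ℚ

/-- The ranking function is computable in polynomial time. -/
def PolyTimeRanking (r : Ranking) : Prop :=
  ∃ (p : Prog) (b : Polynomial ℕ), ∀ (n m : ℕ) (M : Matrix (Fin n) (Fin m) Frac),
    RunsIn p b (encMatrix encFrac M) (encPerm (r n m (M.map Frac.val)))

/-- The effect function is computable in polynomial time. -/
def PolyTimeEffect (e : Effect) : Prop :=
  ∃ (p : Prog) (b : Polynomial ℕ), ∀ (n : ℕ) (a : List ℕ) (π₀ π : Equiv.Perm (Fin n)),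
    ∃ q : Frac, q.val = e n a π₀ π ∧
      RunsIn p b (.node (encList encNat a) (.node (encPerm π₀) (encPerm π))) (encFrac q)

/-- The position of each row in the increasing order of the given keys, where ties are broken by
the row numbers. (`Tuple.sort` maps positions to rows and is stable.) -/
def rankBy {K : Type} [LinearOrder K] {n : ℕ} (key : Fin n → K) : Equiv.Perm (Fin n) :=
  (Tuple.sort key)⁻¹

theorem rankBy_lt_iff {K : Type} [LinearOrder K] {n : ℕ} (key : Fin n → K) (i j : Fin n) :
    rankBy key i < rankBy key j ↔ key i < key j ∨ (key i = key j ∧ i < j) := by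
  have h : ∀ a b : Fin n, a < b → key (Tuple.sort key a) < key (Tuple.sort key b) ∨
      (key (Tuple.sort key a) = key (Tuple.sort key b) ∧
        Tuple.sort key a < Tuple.sort key b) := by
    intro a b hab
    have hm := ((Tuple.eq_sort_iff (f := key) (σ := Tuple.sort key)).1 rfl)
    rcases (hm.1 hab.le).lt_or_eq with h1 | h1
    · exact Or.inl h1
    · exact Or.inr ⟨h1, hm.2 a b hab h1⟩
  have h' : ∀ i j : Fin n, rankBy key i < rankBy key j →
      key i < key j ∨ (key i = key j ∧ i < j) := by
    intro i j hij
    simpa [rankBy] using h _ _ hij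
  refine ⟨h' i j, fun hk => ?_⟩
  rcases lt_trichotomy (rankBy key i) (rankBy key j) with h1 | h1 | h1
  · exact h1
  · obtain rfl := (rankBy key).injective h1
    simp at hk
  · have h2 := h' j i h1
    rcases hk with h3 | ⟨h3, h4⟩ <;> rcases h2 with h5 | ⟨h5, h6⟩
    · exact absurd h3 h5.asymm
    · exact absurd h5 h3.ne'
    · exact absurd h3 h5.ne'
    · exact absurd h4 h6.asymm

/-- The maximum of the entries of a row (`⊥` for the empty row, so that all the rows of a matrix
without columns are tied). -/
def maxScore {m : ℕ} (x : Fin m → ℚ) : WithBot ℚ :=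
  Finset.univ.sup fun j => (x j : WithBot ℚ)

/-- Ranking by increasing maximum. -/
def maxAsc : Ranking := fun _ _ M => rankBy fun i => maxScore (M i)

/-- Ranking by decreasing maximum. -/
def maxDsc : Ranking := fun _ _ M => rankBy fun i => OrderDual.toDual (maxScore (M i))

/-- Ranking by the lexicographic order of the rows, from left to right. -/
noncomputable def lexRank : Ranking := fun _ _ M => rankBy fun i => toLex (M i)

/-- Ranking by increasing sum. -/
def sumAsc : Ranking := fun _ _ M => rankBy fun i => ∑ j, M i j

/-! ### The expected effect -/

/-- A finite probability distribution on numbers, given as a list of value-probability pairs.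
Values are in the format `F`, probabilities are fractions in binary. -/
structure Dist (F : Format) : Type where
  pairs : List (F.Rep × Frac)
  nonneg : ∀ x ∈ pairs, 0 ≤ x.2.val
  sum_eq_one : (pairs.map fun x => x.2.val).sum = 1

/-- Encoding of a distribution, as its list of value-probability pairs. -/
def encDist {F : Format} (D : Dist F) : Data :=
  encList (fun x : F.Rep × Frac => .node (F.enc x.1) (encFrac x.2)) D.pairs

/-- The expectation of `f u`, where the components `u j` are independent and the component `u j`
has the distribution `D j`. -/
def expectation {F : Format} {m : ℕ} (D : Fin m → Dist F) (f : (Fin m → ℚ) → ℚ) : ℚ :=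
  ∑ c : ((j : Fin m) → Fin (D j).pairs.length),
    (∏ j, ((D j).pairs.get (c j)).2.val) * f (fun j => F.val ((D j).pairs.get (c j)).1)

/-- The matrix `M ∘ u`: the column `j` of `M` is multiplied by the weight `u j`. -/
def scaleColumns {n m : ℕ} (M : Matrix (Fin n) (Fin m) ℚ) (u : Fin m → ℚ) :
    Matrix (Fin n) (Fin m) ℚ :=
  Matrix.of fun i j => M i j * u j

/-- The expected effect of the random weights on the ranking, the original order being the ranking
of the rows of `M` itself. -/
def expectedEffect (r : Ranking) (e : Effect) {F : Format} {n m : ℕ}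
    (M : Matrix (Fin n) (Fin m) ℚ) (D : Fin m → Dist F) (a : List ℕ) : ℚ :=
  expectation D fun u => e n a (r n m M) (r n m (scaleColumns M u))

/-- Encoding of an input: matrix, distribution, and additional parameters of the effect. -/
def encInput {F : Format} {n m : ℕ} (M : Matrix (Fin n) (Fin m) F.Rep) (D : Fin m → Dist F)
    (a : List ℕ) : Data :=
  .node (encMatrix F.enc M) (.node (encVec encDist D) (encList encNat a))

/-- The expected effect, for the ranking function `r` and the effect function `e`, can be computed
in polynomial time on all inputs whose matrix entries and weights are given in the format `F`
and whose numbers `n` of rows and `m` of columns satisfy `S n m`. -/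
def ExpPolyTime (F : Format) (r : Ranking) (e : Effect) (S : ℕ → ℕ → Prop) : Prop :=
  ∃ (p : Prog) (b : Polynomial ℕ), ∀ n m : ℕ, S n m →
    ∀ (M : Matrix (Fin n) (Fin m) F.Rep) (D : Fin m → Dist F) (a : List ℕ),
      ∃ q : Frac, q.val = expectedEffect r e (M.map F.val) D a ∧
        RunsIn p b (encInput M D a) (encFrac q)

end ExpEffect

/-! The expectation is a sum over exponentially many weight vectors, but the scaled columns can be
read one after the other while keeping only a state that determines the final ranking. If only
polynomially many states are reachable, each of polynomial size, then the distribution of the state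
can be updated column by column: form all successors of all states, and merge entries with equal
states (`finalStates`). At the end the effect is evaluated once per state (`expPolyTime_of_states`).

The probabilities need care. Merging adds weights, and repeated addition of unreduced fractions
could make their digits multiply from column to column. Therefore the probabilities of each column
are first brought to a common denominator (`commonDen`) and the weights in the lists are integers.
The sum of their absolute values is multiplicative in the columns and cannot grow under merging, so
every weight has at most as many digits as the input to the dynamic program has symbols
(`size_absTotal_finalStates`). The denominators are restored by one product at the end.

With at most `c` columns, the state is the part of the matrix read so far; a product of at most `c`
list lengths bounds the number of states, and any polynomial-time ranking can be applied to the
final one. With at most `c` rows, the state has one key per row, so that `N` possible keys give at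
most `(N + 1) ^ c` states (`expPolyTime_of_keys`). For the maximum, a key is the running maximum of
the row, which is `⊥` or an entry of some scaled column. For the sum, it is a partial sum, an
integer polynomially bounded in absolute value because entries and weights are unary. For the
lexicographic order, it is the number of rows that are smaller on the columns read, hence at most
`c`.

The remaining work shows that all of this runs in polynomial time on the machine model. `PolyTime`
is closed under composition, pairing, case distinction and folds whose intermediate results stay
polynomially small; list operations, binary arithmetic and fractions are built from these, with
`fun_prop` composing them. -/

namespace ExpEffect

/-! ### Polynomial time on encoded types -/

theorem Data.one_le_size (x : Data) : 1 ≤ x.size := by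
  cases x <;> simp [Data.size]

/-- The running time bounds the size of the result. -/
theorem Eval.size_le {p : Prog} {x y : Data} {t : ℕ} (h : Eval p x y t) : y.size ≤ t := by
  induction h with
  | skip | nil => simp [Data.size, Data.one_le_size]
  | fst x | snd x =>
    cases x <;> simp only [Data.size, Data.fst, Data.snd] <;> omega
  | @pair p q x y z s t _ _ h₁ h₂ => have := x.one_le_size; simp only [Data.size]; omega
  | _ => omega

theorem eval_mono (b : Polynomial ℕ) {m n : ℕ} (h : m ≤ n) : b.eval m ≤ b.eval n := by
  rw [Polynomial.eval_eq_sum, Polynomial.eval_eq_sum]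
  exact Finset.sum_le_sum fun i _ => Nat.mul_le_mul_left _ (Nat.pow_le_pow_left h i)

/-- A type whose elements are encoded by trees. -/
class Coded (α : Type) where
  code : α → Data

open Coded

/-- The size of the encoding. -/
def csize {α : Type} [Coded α] (x : α) : ℕ := (code x).size

/-- The function is computed by a program in polynomial time. -/
@[fun_prop]
def PolyTime {α β : Type} [Coded α] [Coded β] (f : α → β) : Prop :=
  ∃ (p : Prog) (b : Polynomial ℕ), ∀ x, RunsIn p b (code x) (code (f x))

/-- The function is bounded by a polynomial in the size of the encoding. -/
def PolyBdd {α : Type} [Coded α] (g : α → ℕ) : Prop :=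
  ∃ b : Polynomial ℕ, ∀ x, g x ≤ b.eval (csize x)

instance : Coded Data := ⟨id⟩
instance : Coded Unit := ⟨fun _ => .leaf⟩
instance : Coded Bool := ⟨encBool⟩
instance {α β : Type} [Coded α] [Coded β] : Coded (α × β) := ⟨fun x => .node (code x.1) (code x.2)⟩
instance {α : Type} [Coded α] : Coded (List α) := ⟨encList code⟩
-- Subtypes express promises: a program for a function on a subtype is only required to be correct
-- and fast on codes of elements that satisfy `P`.
instance {α : Type} [Coded α] {P : α → Prop} : Coded (Subtype P) := ⟨fun x => code x.1⟩
instance : Coded ℕ := ⟨encNat⟩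
instance : Coded ℤ := ⟨encInt⟩
instance : Coded Frac := ⟨encFrac⟩

variable {α β γ X : Type} [Coded α] [Coded β] [Coded γ] [Coded X]

/-! ### Sizes of encoded pairs and lists -/

theorem one_le_csize (x : α) : 1 ≤ csize x := Data.one_le_size _

theorem csize_pair (x : α) (y : β) : csize (x, y) = csize x + csize y + 1 := rfl

theorem csize_nil : csize ([] : List α) = 1 := rfl

theorem csize_cons (x : α) (l : List α) : csize (x :: l) = csize x + csize l + 1 := rfl

theorem csize_append (l l' : List α) : csize (l ++ l') + 1 = csize l + csize l' := by
  induction l with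
  | nil => simp [csize_nil]; omega
  | cons a l ih => simp only [List.cons_append, csize_cons]; omega

theorem csize_list (l : List α) : csize l = (l.map fun a => csize a + 1).sum + 1 := by
  induction l with
  | nil => rfl
  | cons a l ih => simp only [csize_cons, ih, List.map_cons, List.sum_cons]; omega

theorem csize_reverse (l : List α) : csize l.reverse = csize l := by
  simp [csize_list, List.sum_reverse]

theorem length_le_csize (l : List α) : l.length ≤ csize l := by
  induction l with
  | nil => simp
  | cons a l ih => simp only [csize_cons, List.length_cons]; omega

theorem csize_mem_le {l : List α} {a : α} (h : a ∈ l) : csize a ≤ csize l := by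
  induction l with
  | nil => simp at h
  | cons b l ih =>
    rw [csize_cons]
    rcases List.mem_cons.1 h with rfl | h
    · omega
    · have := ih h; omega

theorem csize_le_of_sublist {l l' : List α} (h : l.Sublist l') : csize l ≤ csize l' := by
  induction h with
  | slnil => rfl
  | cons a _ ih => rw [csize_cons]; omega
  | cons_cons a _ ih => rw [csize_cons, csize_cons]; omega

theorem csize_list_le {l : List α} {n b : ℕ} (hn : l.length ≤ n) (hb : ∀ a ∈ l, csize a ≤ b) :
    csize l ≤ n * (b + 1) + 1 := by
  rw [csize_list]
  have : (l.map fun a => csize a + 1).sum ≤ (l.map fun a => csize a + 1).length • (b + 1) := by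
    apply List.sum_le_card_nsmul
    simpa using hb
  rw [List.length_map, smul_eq_mul] at this
  exact Nat.succ_le_succ (this.trans (Nat.mul_le_mul_right _ hn))

/-! #### Polynomial bounds -/

theorem PolyBdd.of_le {g h : α → ℕ} (hh : PolyBdd h) (hg : ∀ x, g x ≤ h x) : PolyBdd g := by
  obtain ⟨b, hb⟩ := hh
  exact ⟨b, fun x => (hg x).trans (hb x)⟩

theorem PolyBdd.const (c : ℕ) : PolyBdd fun _ : α => c := ⟨Polynomial.C c, fun x => by simp⟩

theorem PolyBdd.csize_self : PolyBdd fun x : α => csize x := ⟨.X, fun x => by simp⟩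

theorem PolyBdd.add {g h : α → ℕ} (hg : PolyBdd g) (hh : PolyBdd h) :
    PolyBdd fun x => g x + h x := by
  obtain ⟨b, hb⟩ := hg
  obtain ⟨c, hc⟩ := hh
  exact ⟨b + c, fun x => by simpa using add_le_add (hb x) (hc x)⟩

theorem PolyBdd.mul {g h : α → ℕ} (hg : PolyBdd g) (hh : PolyBdd h) :
    PolyBdd fun x => g x * h x := by
  obtain ⟨b, hb⟩ := hg
  obtain ⟨c, hc⟩ := hh
  exact ⟨b * c, fun x => by simpa using Nat.mul_le_mul (hb x) (hc x)⟩

theorem PolyBdd.pow {g : α → ℕ} (hg : PolyBdd g) (c : ℕ) : PolyBdd fun x => g x ^ c := by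
  obtain ⟨b, hb⟩ := hg
  exact ⟨b ^ c, fun x => by simpa using Nat.pow_le_pow_left (hb x) c⟩

theorem PolyTime.polyBdd {f : α → β} (hf : PolyTime f) : PolyBdd fun x => csize (f x) := by
  obtain ⟨p, b, h⟩ := hf
  refine ⟨b, fun x => ?_⟩
  obtain ⟨t, ht, hb⟩ := h x
  exact ht.size_le.trans hb

theorem PolyBdd.comp {g : β → ℕ} {f : α → β} (hg : PolyBdd g) (hf : PolyTime f) :
    PolyBdd fun x => g (f x) := by
  obtain ⟨b, hb⟩ := hg
  obtain ⟨c, hc⟩ := hf.polyBdd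
  exact ⟨b.comp c, fun x => by
    rw [Polynomial.eval_comp]; exact (hb _).trans (eval_mono b (hc x))⟩

/-! #### Basic closure properties -/

@[fun_prop]
theorem PolyTime.id' : PolyTime fun x : α => x :=
  ⟨.skip, .X, fun x => ⟨_, .skip _, by simp⟩⟩

@[fun_prop]
theorem PolyTime.comp {g : β → γ} {f : α → β} (hg : PolyTime g) (hf : PolyTime f) :
    PolyTime fun x => g (f x) := by
  obtain ⟨p, b, h⟩ := hf
  obtain ⟨q, c, k⟩ := hg
  refine ⟨.seq p q, .X + b + c.comp b, fun x => ?_⟩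
  obtain ⟨t, ht, hb⟩ := h x
  obtain ⟨s, hs, hc⟩ := k (f x)
  refine ⟨_, .seq ht hs, ?_⟩
  -- The intermediate result is no larger than the time spent on producing it.
  have := eval_mono c (ht.size_le.trans hb)
  simp only [Polynomial.eval_add, Polynomial.eval_X, Polynomial.eval_comp]
  omega

@[fun_prop]
theorem PolyTime.prodMk {f : α → β} {g : α → γ} (hf : PolyTime f) (hg : PolyTime g) :
    PolyTime fun x => (f x, g x) := by
  obtain ⟨p, b, h⟩ := hf
  obtain ⟨q, c, k⟩ := hg
  refine ⟨.pair p q, .X + b + c, fun x => ?_⟩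
  obtain ⟨t, ht, hb⟩ := h x
  obtain ⟨s, hs, hc⟩ := k x
  refine ⟨_, .pair ht hs, ?_⟩
  simp only [Polynomial.eval_add, Polynomial.eval_X]
  omega

theorem PolyTime.of_fst {f : α → β} (h : ∀ x, code (f x) = (code x).fst) : PolyTime f :=
  ⟨.fst, .X, fun x => ⟨_, by rw [h]; exact .fst _, by simp⟩⟩

theorem PolyTime.of_snd {f : α → β} (h : ∀ x, code (f x) = (code x).snd) : PolyTime f :=
  ⟨.snd, .X, fun x => ⟨_, by rw [h]; exact .snd _, by simp⟩⟩

theorem PolyTime.of_code_eq {f : α → β} (h : ∀ x, code (f x) = code x) : PolyTime f :=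
  ⟨.skip, .X, fun x => ⟨_, by rw [h]; exact .skip _, by simp⟩⟩

/-- Programs see only codes, so one program serves for all functions whose values have the same
codes, even in different types. -/
theorem PolyTime.congr_code {f : X → α} {g : X → β} (hf : PolyTime f)
    (h : ∀ x, code (g x) = code (f x)) : PolyTime g := by
  obtain ⟨p, b, hp⟩ := hf
  exact ⟨p, b, fun x => by rw [h]; exact hp x⟩

@[fun_prop]
theorem PolyTime.fst {f : α → β × γ} (hf : PolyTime f) : PolyTime fun x => (f x).1 :=
  PolyTime.comp (g := Prod.fst) (of_fst fun _ => rfl) hf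

@[fun_prop]
theorem PolyTime.snd {f : α → β × γ} (hf : PolyTime f) : PolyTime fun x => (f x).2 :=
  PolyTime.comp (g := Prod.snd) (of_snd fun _ => rfl) hf

@[fun_prop]
theorem PolyTime.subtype_val {P : β → Prop} {f : α → Subtype P} (hf : PolyTime f) :
    PolyTime fun x => (f x).1 :=
  PolyTime.comp (g := Subtype.val) (of_code_eq fun _ => rfl) hf

theorem PolyTime.subtype_mk {P : β → Prop} {f : α → β} (hf : PolyTime f) (h : ∀ x, P (f x)) :
    PolyTime fun x => (⟨f x, h x⟩ : Subtype P) := hf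

theorem PolyTime.const_data (d : Data) : PolyTime fun _ : α => d := by
  induction d with
  | leaf => exact ⟨.nil, .X, fun x => ⟨_, .nil _, by simp⟩⟩
  | node a b ha hb => exact PolyTime.congr_code (ha.prodMk hb) fun _ => rfl

@[fun_prop]
theorem PolyTime.const (c : β) : PolyTime fun _ : α => c :=
  PolyTime.congr_code (PolyTime.const_data (code c)) fun _ => rfl

@[fun_prop]
theorem PolyTime.cond {c : α → Bool} {f g : α → β} (hc : PolyTime c) (hf : PolyTime f)
    (hg : PolyTime g) : PolyTime fun x => bif c x then f x else g x := by
  obtain ⟨p, b, h⟩ := hf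
  obtain ⟨q, d, k⟩ := hg
  obtain ⟨r, e, l⟩ := hc
  refine ⟨.cond r p q, .X + b + d + e, fun x => ?_⟩
  obtain ⟨t, ht, hb⟩ := h x
  obtain ⟨s, hs, hd⟩ := k x
  obtain ⟨u, hu, he⟩ := l x
  simp only [RunsIn, Polynomial.eval_add, Polynomial.eval_X]
  cases hcx : c x <;> rw [hcx] at hu
  · exact ⟨_, .condFalse hu hs, by omega⟩
  · exact ⟨_, .condTrue hu ht, by omega⟩

@[fun_prop]
theorem PolyTime.not {c : α → Bool} (hc : PolyTime c) : PolyTime fun x => !c x := by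
  have : PolyTime fun x => bif c x then false else true := by fun_prop
  exact this.congr_code fun x => by cases c x <;> rfl

@[fun_prop]
theorem PolyTime.and {c d : α → Bool} (hc : PolyTime c) (hd : PolyTime d) :
    PolyTime fun x => c x && d x := by
  have : PolyTime fun x => bif c x then d x else false := by fun_prop
  exact this.congr_code fun x => by cases c x <;> rfl

@[fun_prop]
theorem PolyTime.or {c d : α → Bool} (hc : PolyTime c) (hd : PolyTime d) :
    PolyTime fun x => c x || d x := by
  have : PolyTime fun x => bif c x then true else d x := by fun_prop
  exact this.congr_code fun x => by cases c x <;> rfl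

@[fun_prop]
theorem PolyTime.xor {c d : α → Bool} (hc : PolyTime c) (hd : PolyTime d) :
    PolyTime fun x => Bool.xor (c x) (d x) := by
  have : PolyTime fun x => bif c x then !d x else d x := by fun_prop
  exact this.congr_code fun x => by cases c x <;> cases d x <;> rfl

@[fun_prop]
theorem PolyTime.boolEq {c d : α → Bool} (hc : PolyTime c) (hd : PolyTime d) :
    PolyTime fun x => c x == d x := by
  have : PolyTime fun x => bif c x then d x else !d x := by fun_prop
  exact this.congr_code fun x => by cases c x <;> cases d x <;> rfl

@[fun_prop]
theorem PolyTime.cons {f : α → β} {g : α → List β} (hf : PolyTime f) (hg : PolyTime g) :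
    PolyTime fun x => f x :: g x :=
  (hf.prodMk hg).congr_code fun _ => rfl

@[fun_prop]
theorem PolyTime.tail {g : α → List β} (hg : PolyTime g) : PolyTime fun x => (g x).tail :=
  PolyTime.comp (g := List.tail) (of_snd fun l => by cases l <;> rfl) hg

@[fun_prop]
theorem PolyTime.headD {g : α → List β} {f : α → β} (hg : PolyTime g) (hf : PolyTime f) :
    PolyTime fun x => (g x).headD (f x) := by
  obtain ⟨p, b, h⟩ := hg
  obtain ⟨q, c, k⟩ := hf
  refine ⟨.cond p (.seq p .fst) q, .X + .X + b + b + b + c, fun x => ?_⟩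
  obtain ⟨t, ht, hb⟩ := h x
  obtain ⟨s, hs, hc⟩ := k x
  have h1 := ht.size_le
  simp only [RunsIn, Polynomial.eval_add, Polynomial.eval_X]
  cases hcx : g x <;> rw [hcx] at ht h1
  · exact ⟨_, .condFalse ht hs, by omega⟩
  · exact ⟨_, .condTrue ht (.seq ht (.fst _)), by omega⟩

@[fun_prop]
theorem PolyTime.isEmpty {g : α → List β} (hg : PolyTime g) :
    PolyTime fun x => (g x).isEmpty := by
  refine PolyTime.comp (g := List.isEmpty)
    ⟨.cond .skip .nil (.pair .nil .nil), .X + .X + .X + .X + .X, fun l => ?_⟩ hg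
  simp only [RunsIn, Polynomial.eval_add, Polynomial.eval_X]
  cases l with
  | nil => exact ⟨_, .condFalse (.skip _) (.pair (.nil _) (.nil _)), by omega⟩
  | cons a l => exact ⟨_, .condTrue (.skip _) (.nil _), by omega⟩

/-! #### Loops -/

/-- Every round pays for the current tree, the test and the body, each at most `T`; the final test
counts as one more round. -/
theorem Eval.loop_of_steps {c p : Prog} {s : ℕ → Data} {k T : ℕ}
    (hc : ∀ i < k, ∃ a b t, Eval c (s i) (.node a b) t ∧ t ≤ T)
    (hp : ∀ i < k, ∃ t, Eval p (s i) (s (i + 1)) t ∧ t ≤ T)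
    (hk : ∃ t, Eval c (s k) .leaf t ∧ t ≤ T) (hs : ∀ i ≤ k, (s i).size ≤ T) :
    ∃ t, Eval (.loop c p) (s 0) (s k) t ∧ t ≤ (k + 1) * (3 * T) := by
  induction k generalizing s with
  | zero =>
    obtain ⟨t, ht, hT⟩ := hk
    have := hs 0 le_rfl
    exact ⟨_, .loopDone ht, by omega⟩
  | succ k ih =>
    obtain ⟨u, hu, huT⟩ := @ih (fun i => s (i + 1)) (fun i hi => hc _ (by omega))
      (fun i hi => hp _ (by omega)) hk (fun i hi => hs _ (by omega))
    obtain ⟨a, b, t, ht, hT⟩ := hc 0 (by omega)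
    obtain ⟨v, hv, hvT⟩ := hp 0 (by omega)
    refine ⟨_, .loopStep ht hv hu, ?_⟩
    have := hs 0 (by omega)
    have : (k + 1 + 1) * (3 * T) = (k + 1) * (3 * T) + 3 * T := by ring
    omega

/-- A loop runs in polynomial time if its body does, and if the number of iterations and the sizes
of the intermediate states are polynomially bounded. -/
theorem PolyTime.loop {s : X → ℕ → α} {k : X → ℕ} {test : α → Bool} (h0 : PolyTime fun x => s x 0)
    (htest : PolyTime test) (hbody : ∃ (p : Prog) (b : Polynomial ℕ), ∀ x, ∀ i < k x,
      RunsIn p b (code (s x i)) (code (s x (i + 1))))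
    (ht : ∀ x, ∀ i < k x, test (s x i) = true) (hf : ∀ x, test (s x (k x)) = false)
    (hk : PolyBdd k) {B : X → ℕ} (hB : PolyBdd B) (hs : ∀ x, ∀ i ≤ k x, csize (s x i) ≤ B x) :
    PolyTime fun x => s x (k x) := by
  obtain ⟨p₀, b₀, h0⟩ := h0
  obtain ⟨c, bc, hc⟩ := htest
  obtain ⟨p, b, hp⟩ := hbody
  obtain ⟨bk, hk⟩ := hk
  obtain ⟨bB, hB⟩ := hB
  refine ⟨.seq p₀ (.loop c p), .X + b₀ + (bk + 1) * (3 * (bB + bc.comp bB + b.comp bB)),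
    fun x => ?_⟩
  obtain ⟨t₀, ht₀, hb₀⟩ := h0 x
  have hsz : ∀ i ≤ k x, csize (s x i) ≤ bB.eval (csize x) := fun i hi => (hs x i hi).trans (hB x)
  have hcT : ∀ i ≤ k x, ∃ t, Eval c (code (s x i)) (code (test (s x i))) t ∧
      t ≤ (bc.comp bB).eval (csize x) := fun i hi => by
    obtain ⟨t, ht, hb⟩ := hc (s x i)
    exact ⟨t, ht, hb.trans (by rw [Polynomial.eval_comp]; exact eval_mono _ (hsz i hi))⟩
  obtain ⟨u, hu, hT⟩ := @Eval.loop_of_steps c p (fun i => code (s x i)) (k x)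
    ((bB + bc.comp bB + b.comp bB).eval (csize x))
    (fun i hi => by
      obtain ⟨t, h, hb⟩ := hcT i hi.le
      rw [ht x i hi] at h
      exact ⟨_, _, t, h, hb.trans (by simp only [Polynomial.eval_add]; omega)⟩)
    (fun i hi => by
      obtain ⟨t, h, hb⟩ := hp x i hi
      refine ⟨t, h, hb.trans ?_⟩
      simp only [Polynomial.eval_add, Polynomial.eval_comp]
      exact (eval_mono b (hsz i hi.le)).trans (by omega))
    (by
      obtain ⟨t, h, hb⟩ := hcT _ le_rfl
      rw [hf x] at h
      exact ⟨t, h, hb.trans (by simp only [Polynomial.eval_add]; omega)⟩)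
    (fun i hi => (hsz i hi).trans (by simp only [Polynomial.eval_add]; omega))
  refine ⟨_, .seq ht₀ hu, ?_⟩
  have h1 : (k x + 1) * (3 * (bB + bc.comp bB + b.comp bB).eval (csize x)) ≤
      (bk.eval (csize x) + 1) * (3 * (bB + bc.comp bB + b.comp bB).eval (csize x)) :=
    Nat.mul_le_mul_right _ (Nat.succ_le_succ (hk x))
  have h2 : Polynomial.eval (code x).size (3 : Polynomial ℕ) = 3 := Polynomial.eval_ofNat _ _
  simp only [Polynomial.eval_add, Polynomial.eval_X, Polynomial.eval_mul, Polynomial.eval_one,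
    h2, csize] at *
  omega

/-- Left folds, with an invariant `I` for the states from which a step is taken. -/
theorem PolyTime.foldl_of_inv {l : X → List α} {init : X → β} {step : X → β → α → β}
    (I : X × β × α → Prop)
    (hstep : PolyTime fun y : {y // I y} => step y.1.1 y.1.2.1 y.1.2.2)
    (hl : PolyTime l) (hi : PolyTime init)
    (hI : ∀ x l₁ a l₂, l x = l₁ ++ a :: l₂ → I (x, l₁.foldl (step x) (init x), a))
    {B : X → ℕ} (hB : PolyBdd B)
    (hb : ∀ x l₁ l₂, l x = l₁ ++ l₂ → csize (l₁.foldl (step x) (init x)) ≤ B x) :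
    PolyTime fun x => (l x).foldl (step x) (init x) := by
  -- The loop carries the input, the unread part of the list and the accumulator; the input is kept
  -- because the step may depend on it.
  let s : X → ℕ → X × List α × β := fun x i =>
    (x, (l x).drop i, ((l x).take i).foldl (step x) (init x))
  have key : PolyTime fun x => s x (l x).length := by
    refine PolyTime.loop (test := fun y => !y.2.1.isEmpty)
      (B := fun x => csize x + (csize (l x) + B x + 1) + 1) ?_ (by fun_prop) ?_ ?_ ?_ ?_ ?_ ?_
    · exact (by fun_prop : PolyTime fun x => (x, l x, init x))
    -- The head is taken on nonempty lists only, so no default element of `α` is needed. The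
    -- predicate `J` below joins this promise with the invariant `I`.
    · have hd : PolyTime fun y : {l : List α // l ≠ []} => y.1.head y.2 := of_fst fun y => by
        obtain ⟨_ | ⟨a, l⟩, h⟩ := y
        · exact absurd rfl h
        · rfl
      let J : X × List α × β → Prop := fun y => ∃ h : y.2.1 ≠ [], I (y.1, y.2.2, y.2.1.head h)
      have h1 : PolyTime fun y : {y : X × List α × β // J y} =>
          (⟨y.1.2.1, y.2.1⟩ : {l : List α // l ≠ []}) :=
        subtype_mk (f := fun y : {y : X × List α × β // J y} => y.1.2.1) (by fun_prop) _
      have h2 : PolyTime fun y : {y : X × List α × β // J y} =>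
          (⟨(y.1.1, y.1.2.2, y.1.2.1.head y.2.1), y.2.2⟩ : {y // I y}) :=
        subtype_mk (f := fun y : {y : X × List α × β // J y} =>
          (y.1.1, y.1.2.2, y.1.2.1.head y.2.1))
          (by have := hd.comp h1; fun_prop) _
      have h3 := hstep.comp h2
      have h4 : PolyTime fun y : {y : X × List α × β // J y} =>
        (y.1.1, y.1.2.1.tail, step y.1.1 y.1.2.2 (y.1.2.1.head y.2.1)) :=
        prodMk (by fun_prop) (prodMk (by fun_prop) h3)
      obtain ⟨p, b, hp⟩ := h4
      refine ⟨p, b, fun x i hi => ?_⟩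
      have hd := List.drop_eq_getElem_cons hi
      have e := List.take_append_drop i (l x)
      rw [hd] at e
      have hne : (l x).drop i ≠ [] := by rw [hd]; exact List.cons_ne_nil _ _
      have hhead : ((l x).drop i).head hne = (l x)[i] := List.head_drop hne
      have hJ : J (s x i) := ⟨hne, by
        change I (x, _, ((l x).drop i).head hne)
        rw [hhead]
        exact hI x _ _ _ e.symm⟩
      have h5 : s x (i + 1) = (x, ((l x).drop i).tail,
          step x (((l x).take i).foldl (step x) (init x)) (((l x).drop i).head hne)) := by
        simp only [s, List.tail_drop, List.take_succ_eq_append_getElem hi, List.foldl_append,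
          List.foldl_cons, List.foldl_nil, hhead]
      rw [h5]
      exact hp ⟨s x i, hJ⟩
    · intro x i hi; simp [s, hi]
    · intro x; simp [s]
    · exact PolyBdd.of_le (hl.polyBdd) fun x => length_le_csize _
    · exact (PolyBdd.csize_self.add ((hl.polyBdd.add hB).add (.const 1))).add (.const 1)
    · intro x i _
      have h1 := hb x _ _ (List.take_append_drop i (l x)).symm
      have h2 := csize_le_of_sublist (List.drop_sublist i (l x))
      simp only [s, csize_pair]
      omega
  have h2 := key.snd.snd
  simpa [s] using h2

theorem PolyTime.foldl {l : X → List α} {init : X → β} {step : X → β → α → β}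
    (hstep : PolyTime fun y : X × β × α => step y.1 y.2.1 y.2.2)
    (hl : PolyTime l) (hi : PolyTime init) {B : X → ℕ} (hB : PolyBdd B)
    (hb : ∀ x l₁ l₂, l x = l₁ ++ l₂ → csize (l₁.foldl (step x) (init x)) ≤ B x) :
    PolyTime fun x => (l x).foldl (step x) (init x) :=
  foldl_of_inv (fun _ => True)
    (hstep.comp (f := fun y : {_y : X × β × α // True} => y.1) (by fun_prop)) hl hi
    (fun _ _ _ _ _ => trivial) hB hb

/-- Left folds in which each step increases the size by a bounded amount only. -/
theorem PolyTime.foldl_of_growth {l : X → List α} {init : X → β} {step : X → β → α → β}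
    (hstep : PolyTime fun y : X × β × α => step y.1 y.2.1 y.2.2)
    (hl : PolyTime l) (hi : PolyTime init) (μ : β → ℕ) (c : ℕ) (hμ : ∀ s, csize s ≤ c * μ s + c)
    (hμ' : ∀ s, μ s ≤ csize s) {g : X → ℕ} (hg : PolyBdd g)
    (h : ∀ x s, ∀ a ∈ l x, μ (step x s a) ≤ μ s + g x) :
    PolyTime fun x => (l x).foldl (step x) (init x) := by
  -- Growth is measured by `μ`, which agrees with `csize` up to the constant `c`. The constant then
  -- enters once, at the end, instead of once per step.
  refine foldl hstep hl hi
    (B := fun x => c * (csize (init x) + csize (l x) * g x) + c)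
    (((PolyBdd.const c).mul (hi.polyBdd.add (hl.polyBdd.mul hg))).add (.const c))
    fun x l₁ l₂ e => ?_
  have key : ∀ (l' : List α) (s : β), (∀ a ∈ l', a ∈ l x) →
      μ (l'.foldl (step x) s) ≤ μ s + l'.length * g x := by
    intro l'
    induction l' with
    | nil => simp
    | cons a l' ih =>
      intro s hs
      have h1 := ih (step x s a) fun b hb => hs b (by simp [hb])
      have h2 := h x s a (hs a (by simp))
      simp only [List.foldl_cons, List.length_cons, add_mul, one_mul]
      omega
  have h1 := key l₁ (init x) fun a ha => by simp [e, ha]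
  have h2 := length_le_csize (l x)
  have h3 : l₁.length * g x ≤ csize (l x) * g x :=
    Nat.mul_le_mul_right _ (by rw [e, List.length_append] at h2; rw [e]; omega)
  exact (hμ _).trans (Nat.add_le_add_right (Nat.mul_le_mul_left _
    (h1.trans (by have := hμ' (init x); omega))) _)

/-! ### Lists -/

theorem PolyTime.foldr {l : X → List α} {init : X → β} {step : X → α → β → β}
    (hstep : PolyTime fun y : X × α × β => step y.1 y.2.1 y.2.2)
    (hl : PolyTime fun x => (l x).reverse) (hi : PolyTime init) {B : X → ℕ} (hB : PolyBdd B)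
    (hb : ∀ x l₁ l₂, l x = l₁ ++ l₂ → csize (l₂.foldr (step x) (init x)) ≤ B x) :
    PolyTime fun x => (l x).foldr (step x) (init x) := by
  have := foldl (l := fun x => (l x).reverse) (init := init) (step := fun x s a => step x a s)
    (B := B) (hstep.comp (f := fun y : X × β × α => (y.1, y.2.2, y.2.1)) (by fun_prop)) hl hi hB
    fun x l₁ l₂ e => by
      have e' := congrArg List.reverse e
      rw [List.reverse_reverse, List.reverse_append] at e'
      have := hb x _ _ e'
      rwa [List.foldr_reverse] at this
  simpa using this

@[fun_prop]
theorem PolyTime.reverse {l : X → List α} (hl : PolyTime l) :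
    PolyTime fun x => (l x).reverse := by
  have : PolyTime fun x => (l x).foldl (fun s a => a :: s) [] :=
    foldl (step := fun _ s a => a :: s) (by fun_prop) hl (by fun_prop) hl.polyBdd
      fun x l₁ l₂ e => by
        have h1 : l₁.foldl (fun s a => a :: s) [] = l₁.reverse := by simp
        rw [h1, csize_reverse, e]
        exact csize_le_of_sublist (List.sublist_append_left l₁ l₂)
  simpa using this

@[fun_prop]
theorem PolyTime.append {l l' : X → List α} (hl : PolyTime l) (hl' : PolyTime l') :
    PolyTime fun x => l x ++ l' x := by
  have : PolyTime fun x => (l x).foldr (fun a s => a :: s) (l' x) :=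
    foldr (step := fun _ a s => a :: s) (by fun_prop) (by fun_prop) hl'
      (hl.polyBdd.add hl'.polyBdd) fun x l₁ l₂ e => by
        have h1 := csize_le_of_sublist (List.sublist_append_right l₁ l₂)
        have h2 := csize_append l₂ (l' x)
        rw [← e] at h1
        have h3 : l₂.foldr (fun a s => a :: s) (l' x) = l₂ ++ l' x := by simp
        rw [h3]
        omega
  simpa using this

/-- The images are consed while the reversed list is read. The list of images has polynomial size
because each of them is computed from `x` and one element of `l x`. -/
theorem PolyTime.map_of_inv {l : X → List α} {f : X → α → β} (I : X × α → Prop)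
    (hf : PolyTime fun y : {y // I y} => f y.1.1 y.1.2) (hl : PolyTime l)
    (hI : ∀ x, ∀ a ∈ l x, I (x, a)) : PolyTime fun x => (l x).map (f x) := by
  obtain ⟨b, hb⟩ := hf.polyBdd
  have key : ∀ x (l' : List α), l'.foldl (fun s a => f x a :: s) [] = (l'.map (f x)).reverse := by
    intro x l'
    rw [← List.foldr_reverse]
    simp [← List.map_reverse]
  have : PolyTime fun x => ((l x).reverse).foldl (fun s a => f x a :: s) [] := by
    refine foldl_of_inv (step := fun x s a => f x a :: s) (fun y => I (y.1, y.2.2)) ?_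
      (by fun_prop) (by fun_prop) ?_
      (B := fun x => csize (l x) * (b.eval (csize x + csize (l x) + 1) + 1) + 1) ?_ ?_
    · have h1 : PolyTime fun y : {y : X × List β × α // I (y.1, y.2.2)} =>
          (⟨(y.1.1, y.1.2.2), y.2⟩ : {y // I y}) :=
        subtype_mk (f := fun y : {y : X × List β × α // I (y.1, y.2.2)} => (y.1.1, y.1.2.2))
          (by fun_prop) _
      have h2 := hf.comp h1
      have h3 : PolyTime fun y : {y : X × List β × α // I (y.1, y.2.2)} => y.1.2.1 := by fun_prop
      exact h2.cons h3
    · intro x l₁ a l₂ e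
      exact hI x a (by rw [← List.mem_reverse, e]; simp)
    · refine (hl.polyBdd.mul (PolyBdd.add ?_ (.const 1))).add (.const 1)
      obtain ⟨c, hc⟩ := hl.polyBdd
      exact ⟨b.comp (.X + c + 1), fun x => by
        rw [Polynomial.eval_comp]
        exact eval_mono b (by simpa using hc x)⟩
    · intro x l₁ l₂ e
      have hsub : ∀ a ∈ l₁, a ∈ l x := fun a ha => by rw [← List.mem_reverse, e]; simp [ha]
      rw [key, csize_reverse]
      refine csize_list_le ?_ ?_
      · rw [List.length_map]
        have := congrArg List.length e
        have := length_le_csize (l x)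
        simp at *
        omega
      · simp only [List.mem_map, forall_exists_index, and_imp, forall_apply_eq_imp_iff₂]
        intro a ha
        refine (hb ⟨(x, a), hI x a (hsub a ha)⟩).trans (eval_mono b ?_)
        have := csize_mem_le (hsub a ha)
        change csize (x, a) ≤ _
        rw [csize_pair]
        omega
  simpa [key] using this

@[fun_prop]
theorem PolyTime.map {l : X → List α} {f : X → α → β}
    (hf : PolyTime fun y : X × α => f y.1 y.2) (hl : PolyTime l) :
    PolyTime fun x => (l x).map (f x) :=
  map_of_inv (fun _ => True) (hf.comp (f := fun y : {_y : X × α // True} => y.1) (by fun_prop)) hl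
    fun _ _ _ => trivial

@[fun_prop]
theorem PolyTime.flatten {l : X → List (List α)} (hl : PolyTime l) :
    PolyTime fun x => (l x).flatten := by
  have h : ∀ l' : List (List α), csize l'.flatten ≤ csize l' := by
    intro l'
    induction l' with
    | nil => simp [csize_nil]
    | cons a l' ih =>
      have := csize_append a l'.flatten
      simp only [List.flatten_cons, csize_cons]
      omega
  have h' : ∀ l' : List (List α), l'.foldr (fun a s => a ++ s) [] = l'.flatten := by
    intro l'
    induction l' with
    | nil => rfl
    | cons a l' ih => simp [ih]
  have : PolyTime fun x => (l x).foldr (fun a s => a ++ s) [] :=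
    foldr (step := fun _ a s => a ++ s) (by fun_prop) (by fun_prop) (by fun_prop)
      hl.polyBdd fun x l₁ l₂ e => by
        have h1 := csize_le_of_sublist (List.sublist_append_right l₁ l₂)
        rw [← e] at h1
        rw [h']
        exact (h _).trans h1
  simpa [h'] using this

@[fun_prop]
theorem PolyTime.filter {l : X → List α} {f : X → α → Bool}
    (hf : PolyTime fun y : X × α => f y.1 y.2) (hl : PolyTime l) :
    PolyTime fun x => (l x).filter (f x) := by
  have h : PolyTime fun x => ((l x).map fun a => bif f x a then [a] else []).flatten := by
    fun_prop
  refine h.congr_code fun x => congrArg code ?_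
  induction l x with
  | nil => rfl
  | cons a l ih => cases h : f x a <;> simp [h, ih]

@[fun_prop]
theorem PolyTime.any {l : X → List α} {f : X → α → Bool}
    (hf : PolyTime fun y : X × α => f y.1 y.2) (hl : PolyTime l) :
    PolyTime fun x => (l x).any (f x) := by
  have h : PolyTime fun x => !((l x).filter (f x)).isEmpty := by fun_prop
  refine h.congr_code fun x => congrArg code ?_
  rw [Bool.eq_iff_iff]
  simp

@[fun_prop]
theorem PolyTime.zip [Inhabited β] {l : X → List α} {l' : X → List β} (hl : PolyTime l)
    (hl' : PolyTime l') : PolyTime fun x => (l x).zip (l' x) := by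
  -- The state holds the unread part of the second list and the pairs found so far, in reverse. The
  -- default is never used, as the head is taken of a nonempty list.
  let step : List β × List (α × β) → α → List β × List (α × β) := fun s a =>
    bif s.1.isEmpty then s else (s.1.tail, (a, s.1.headD default) :: s.2)
  have h : ∀ (l : List α) (l' : List β) (r : List (α × β)),
      (l.foldl step (l', r)).2.reverse = r.reverse ++ l.zip l' := by
    intro l
    induction l with
    | nil => simp
    | cons a l ih =>
      intro l' r
      cases l' with
      | nil =>
        rw [List.foldl_cons]
        change (l.foldl step ([], r)).2.reverse = _
        simp [ih]
      | cons b l' =>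
        rw [List.foldl_cons]
        change (l.foldl step (l', (a, b) :: r)).2.reverse = _
        simp [ih]
  have h2 : PolyTime fun x => (l x).foldl step (l' x, []) := by
    -- The second entry of a new pair has just left the unread part, so only the entry from `l x`
    -- and a constant count as growth.
    refine foldl_of_growth (step := fun _ => step) (by fun_prop) hl (by fun_prop)
      csize 1 (by simp) (by simp) (g := fun x => csize (l x) + 2) (hl.polyBdd.add (.const 2)) ?_
    rintro x ⟨r, s⟩ a ha
    have := csize_mem_le ha
    cases r with
    | nil => exact Nat.le_add_right _ _
    | cons b r =>
      change csize (r, (a, b) :: s) ≤ _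
      simp only [csize_pair, csize_cons]
      omega
  have h3 : PolyTime fun x => ((l x).foldl step (l' x, [])).2.reverse := by fun_prop
  simpa [h] using h3

/-- Equality is decidable in polynomial time. -/
class PolyTimeEq (α : Type) [Coded α] [DecidableEq α] : Prop where
  polyTime_eq : PolyTime fun y : α × α => decide (y.1 = y.2)

@[fun_prop]
theorem PolyTime.decide_eq [DecidableEq α] [PolyTimeEq α] {f g : X → α} (hf : PolyTime f)
    (hg : PolyTime g) : PolyTime fun x => decide (f x = g x) :=
  (PolyTimeEq.polyTime_eq (α := α)).comp (hf.prodMk hg)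

theorem PolyTimeEq.of_injective [DecidableEq α] [DecidableEq β] [PolyTimeEq β] {f : α → β}
    (hf : PolyTime f) (hinj : f.Injective) : PolyTimeEq α :=
  ⟨(PolyTime.decide_eq (hf.comp PolyTime.id'.fst) (hf.comp PolyTime.id'.snd)).congr_code fun y => by
    simp [hinj.eq_iff]⟩

instance : PolyTimeEq Bool :=
  ⟨(PolyTime.id'.fst.boolEq PolyTime.id'.snd).congr_code fun y => by
    rcases y with ⟨_ | _, _ | _⟩ <;> rfl⟩

instance [DecidableEq α] [DecidableEq β] [PolyTimeEq α] [PolyTimeEq β] : PolyTimeEq (α × β) :=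
  ⟨((PolyTime.decide_eq (X := (α × β) × (α × β)) PolyTime.id'.fst.fst PolyTime.id'.snd.fst).and
    (PolyTime.decide_eq PolyTime.id'.fst.snd PolyTime.id'.snd.snd)).congr_code fun y => by
    simp [Prod.ext_iff]⟩

instance [DecidableEq α] [PolyTimeEq α] : PolyTimeEq (List α) := by
  -- The state records whether all entries agreed so far, and the unread part of the second list.
  -- The default `a` of `headD` would make the comparison succeed, so emptiness is tested
  -- separately.
  let step : Bool × List α → α → Bool × List α := fun s a =>
    (!s.2.isEmpty && (s.1 && decide (a = s.2.headD a)), s.2.tail)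
  have h : ∀ (l l' : List α) (b : Bool),
      ((l.foldl step (b, l')).1 && (l.foldl step (b, l')).2.isEmpty) =
        (b && decide (l = l')) := by
    intro l
    induction l with
    | nil => intro l' b; cases l' <;> simp
    | cons a l ih =>
      intro l' b
      cases l' with
      | nil =>
        rw [List.foldl_cons]
        change ((l.foldl step (false, [])).1 && (l.foldl step (false, [])).2.isEmpty) = _
        simp [ih]
      | cons a' l' =>
        rw [List.foldl_cons]
        change ((l.foldl step (b && decide (a = a'), l')).1 &&
          (l.foldl step (b && decide (a = a'), l')).2.isEmpty) = _
        simp [ih, Bool.and_assoc]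
  have h1 : PolyTime fun y : (List α × List α) × (Bool × List α) × α => step y.2.1 y.2.2 := by
    change PolyTime fun y : (List α × List α) × (Bool × List α) × α =>
      (!y.2.1.2.isEmpty && (y.2.1.1 && decide (y.2.2 = y.2.1.2.headD y.2.2)), y.2.1.2.tail)
    fun_prop
  have h2 : PolyTime fun y : List α × List α => y.1.foldl step (true, y.2) := by
    refine PolyTime.foldl_of_growth (step := fun _ => step) h1 (by fun_prop) (by fun_prop)
      csize 1 (by simp) (by simp) (g := fun x => 2) (.const 2) ?_
    rintro x ⟨b, s⟩ a ha
    have h1 := csize_le_of_sublist (List.tail_sublist s)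
    have h2 : ∀ b : Bool, csize b ≤ 3 := by intro b; cases b <;> decide
    have h3 := one_le_csize b
    have h4 := h2 (!s.isEmpty && (b && decide (a = s.headD a)))
    change csize (_, s.tail) ≤ _
    simp only [csize_pair]
    omega
  have h3 : PolyTime fun y : List α × List α =>
    (y.1.foldl step (true, y.2)).1 && (y.1.foldl step (true, y.2)).2.isEmpty := by fun_prop
  exact ⟨by simpa [h] using h3⟩

/-! ### Binary arithmetic -/

theorem csize_bool_le (b : Bool) : csize b ≤ 3 := by cases b <;> decide

theorem csize_nat_le (n : ℕ) : csize n ≤ 4 * n.size + 1 := by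
  change csize n.bits ≤ _
  rw [← Nat.size_eq_bits_len]
  refine (csize_list_le le_rfl fun b _ => csize_bool_le b).trans ?_
  omega

theorem size_le_csize (n : ℕ) : n.size ≤ csize n := by
  rw [← Nat.size_eq_bits_len]
  exact length_le_csize n.bits

theorem foldr_bit_bits (n : ℕ) : n.bits.foldr Nat.bit 0 = n := by
  induction n using Nat.binaryRec' with
  | zero => simp
  | bit b n h ih => rw [Nat.bits_append_bit n b h, List.foldr_cons, ih]

@[fun_prop]
theorem PolyTime.bits {f : X → ℕ} (hf : PolyTime f) : PolyTime fun x => (f x).bits :=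
  hf.congr_code fun _ => rfl

instance : PolyTimeEq ℕ :=
  .of_injective (f := Nat.bits) (by fun_prop) fun a b h => by
    rw [← foldr_bit_bits a, h, foldr_bit_bits]

@[fun_prop]
theorem PolyTime.bodd {f : X → ℕ} (hf : PolyTime f) : PolyTime fun x => (f x).bodd := by
  have : PolyTime fun x => (f x).bits.headD false := by fun_prop
  refine this.congr_code fun x => ?_
  rw [Nat.bodd_eq_bits_head]
  cases (f x).bits <;> rfl

@[fun_prop]
theorem PolyTime.div2 {f : X → ℕ} (hf : PolyTime f) : PolyTime fun x => (f x).div2 := by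
  have : PolyTime fun x => (f x).bits.tail := by fun_prop
  refine this.congr_code fun x => ?_
  rw [← Nat.div2_bits_eq_tail]
  rfl

@[fun_prop]
theorem PolyTime.bit {b : X → Bool} {f : X → ℕ} (hb : PolyTime b) (hf : PolyTime f) :
    PolyTime fun x => Nat.bit (b x) (f x) := by
  -- The number `0` has no digits, so a zero digit must not be put in front of the empty list.
  have : PolyTime fun x =>
    bif b x || !(f x).bits.isEmpty then b x :: (f x).bits else [] := by fun_prop
  refine this.congr_code fun x => ?_
  change code (Nat.bit (b x) (f x)).bits = _
  congr 1
  by_cases h : f x = 0 → b x = true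
  · rw [Nat.bits_append_bit _ _ h]
    cases hb : b x
    · have h0 : f x ≠ 0 := fun h0 => by simp [h h0] at hb
      have : (f x).bits ≠ [] := fun h1 => h0 (by rw [← foldr_bit_bits (f x), h1]; rfl)
      cases h2 : (f x).bits
      · exact absurd h2 this
      · rfl
    · rfl
  · rw [Classical.not_imp] at h
    rw [h.1, Bool.eq_false_iff.2 h.2]
    simp

/-- The number whose binary digits, from the most significant one on, are given. -/
def ofDigits (l : List Bool) : ℕ := l.foldl (fun n b => Nat.bit b n) 0

theorem foldl_bit (l : List Bool) (n : ℕ) :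
    l.foldl (fun n b => Nat.bit b n) n = 2 ^ l.length * n + ofDigits l := by
  rw [ofDigits]
  induction l generalizing n with
  | nil => simp
  | cons b l ih =>
    rw [List.foldl_cons, List.foldl_cons, ih, ih (Nat.bit b 0), Nat.bit_val, Nat.bit_val,
      List.length_cons]
    ring

theorem ofDigits_cons (b : Bool) (l : List Bool) :
    ofDigits (b :: l) = 2 ^ l.length * b.toNat + ofDigits l := by
  rw [ofDigits, List.foldl_cons, foldl_bit, Nat.bit_val]
  ring

theorem ofDigits_lt (l : List Bool) : ofDigits l < 2 ^ l.length := by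
  induction l with
  | nil => simp [ofDigits]
  | cons b l ih =>
    rw [ofDigits_cons, List.length_cons, pow_succ]
    have := Nat.mul_le_mul_left (2 ^ l.length) (Bool.toNat_le b)
    omega

theorem csize_bit_le (b : Bool) (n : ℕ) : csize (Nat.bit b n) ≤ csize n + 4 := by
  change csize (Nat.bit b n).bits ≤ csize n.bits + 4
  by_cases h : n = 0 → b = true
  · rw [Nat.bits_append_bit _ _ h, csize_cons]
    have := csize_bool_le b
    omega
  · rw [Classical.not_imp] at h
    rw [h.1, Bool.eq_false_iff.2 h.2]
    simp

@[fun_prop]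
theorem PolyTime.ofDigits {l : X → List Bool} (hl : PolyTime l) :
    PolyTime fun x => ofDigits (l x) :=
  foldl_of_growth (step := fun _ n b => Nat.bit b n) (by fun_prop) hl (by fun_prop) csize 1
    (by simp) (by simp) (.const 4) fun _ n b _ => csize_bit_le b n

/-- One step of a digit by digit computation on two numbers: the state consists of the rest of the
numbers, the carry, and the list of the digits found. -/
def rippleStep (f g : Bool → Bool → Bool → Bool) (s : ℕ × ℕ × Bool × List Bool) :
    ℕ × ℕ × Bool × List Bool :=
  (s.1.div2, s.2.1.div2, g s.1.bodd s.2.1.bodd s.2.2.1,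
    f s.1.bodd s.2.1.bodd s.2.2.1 :: s.2.2.2)

/-- Digit by digit computation on two numbers, where `f` is the function for the digits and `g` the
one for the carry. -/
def ripple (f g : Bool → Bool → Bool → Bool) (a b : ℕ) : Bool × ℕ :=
  let s := (true :: (a.bits ++ b.bits)).foldl (fun s _ => rippleStep f g s) (a, b, false, [])
  (s.2.2.1, ofDigits s.2.2.2)

/-- With `ε = 1` this covers addition, with `ε = -1` subtraction, the carry having the sign `ε`. The
hypothesis is the identity for one digit. By it, the number found so far plus `2 ^ (digits found)`
times the signed rest, carry included, is invariant. The newest digit is the most significant one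
and stands first, as `ofDigits` expects. -/
theorem ripple_spec {f g : Bool → Bool → Bool → Bool} {ε : ℤ}
    (h : ∀ x y c : Bool, (x.toNat : ℤ) + ε * y.toNat + ε * c.toNat =
      (f x y c).toNat + 2 * (ε * (g x y c).toNat)) (a b : ℕ) :
    ∃ k : ℕ, a + b < 2 ^ k ∧ (ripple f g a b).2 < 2 ^ k ∧
      (a : ℤ) + ε * b = (ripple f g a b).2 + 2 ^ k * (ε * (ripple f g a b).1.toNat) := by
  have key : ∀ (l : List Bool) (s : ℕ × ℕ × Bool × List Bool),
      let s' := l.foldl (fun s _ => rippleStep f g s) s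
      s'.1 = s.1 / 2 ^ l.length ∧ s'.2.1 = s.2.1 / 2 ^ l.length ∧
      s'.2.2.2.length = s.2.2.2.length + l.length ∧
      (ofDigits s'.2.2.2 : ℤ) + 2 ^ s'.2.2.2.length * (s'.1 + ε * s'.2.1 + ε * s'.2.2.1.toNat) =
        ofDigits s.2.2.2 + 2 ^ s.2.2.2.length * (s.1 + ε * s.2.1 + ε * s.2.2.1.toNat) := by
    intro l
    induction l with
    | nil => simp
    | cons _ l ih =>
      intro s
      obtain ⟨h1, h2, h3, h4⟩ := ih (rippleStep f g s)
      simp only [List.foldl_cons]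
      refine ⟨?_, ?_, ?_, ?_⟩
      · rw [h1, List.length_cons, pow_succ', ← Nat.div_div_eq_div_mul]; rfl
      · rw [h2, List.length_cons, pow_succ', ← Nat.div_div_eq_div_mul]; rfl
      · rw [h3, List.length_cons, rippleStep, List.length_cons]; omega
      · rw [h4]
        obtain ⟨a, b, c, o⟩ := s
        simp only [rippleStep, ofDigits_cons, List.length_cons]
        have ha := Nat.bodd_add_div2 a
        have hb := Nat.bodd_add_div2 b
        zify at ha hb
        push_cast
        have := h a.bodd b.bodd c
        linear_combination (2 : ℤ) ^ o.length * (ha + ε * hb - this)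
  obtain ⟨h1, h2, h3, h4⟩ := key (true :: (a.bits ++ b.bits)) (a, b, false, [])
  -- So many rounds use up all digits of both numbers, and the additional round leaves room for
  -- their sum.
  have hlen : (true :: (a.bits ++ b.bits)).length = a.size + b.size + 1 := by
    simp [Nat.size_eq_bits_len]
  have ha : a < 2 ^ (a.size + b.size) :=
    (Nat.lt_size_self a).trans_le (Nat.pow_le_pow_right (by norm_num) (by omega))
  have hb : b < 2 ^ (a.size + b.size) :=
    (Nat.lt_size_self b).trans_le (Nat.pow_le_pow_right (by norm_num) (by omega))
  have hp : 2 ^ (a.size + b.size + 1) = 2 * 2 ^ (a.size + b.size) := pow_succ' _ _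
  rw [hlen] at h1 h2 h3
  rw [Nat.div_eq_of_lt (by change a < _; omega)] at h1
  rw [Nat.div_eq_of_lt (by change b < _; omega)] at h2
  simp only [List.length_nil, zero_add] at h3
  refine ⟨a.size + b.size + 1, by omega, ?_, ?_⟩
  · rw [← h3]; exact ofDigits_lt _
  · rw [h1, h2, h3] at h4
    simp only [ofDigits, List.foldl_nil, List.length_nil, Bool.toNat_false] at h4
    simp only [ripple, ofDigits]
    push_cast at h4 ⊢
    linear_combination -h4

theorem PolyTime.ripple {f g : Bool → Bool → Bool → Bool} {a b : X → ℕ}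
    (hf : PolyTime fun y : Bool × Bool × Bool => f y.1 y.2.1 y.2.2)
    (hg : PolyTime fun y : Bool × Bool × Bool => g y.1 y.2.1 y.2.2)
    (ha : PolyTime a) (hb : PolyTime b) : PolyTime fun x => ripple f g (a x) (b x) := by
  have hstep : PolyTime (rippleStep f g) := by
    have h : PolyTime fun s : ℕ × ℕ × Bool × List Bool => (s.1.bodd, s.2.1.bodd, s.2.2.1) := by
      fun_prop
    have h1 := hf.comp h
    have h2 := hg.comp h
    have h3 : PolyTime fun s : ℕ × ℕ × Bool × List Bool => (s.1.div2, s.2.1.div2) := by fun_prop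
    have h4 : PolyTime fun s : ℕ × ℕ × Bool × List Bool => s.2.2.2 := by fun_prop
    exact h3.fst.prodMk (h3.snd.prodMk (h2.prodMk (h1.cons h4)))
  have hdiv : ∀ n : ℕ, csize n.div2 ≤ csize n := fun n => by
    change csize n.div2.bits ≤ csize n.bits
    rw [Nat.div2_bits_eq_tail]
    exact csize_le_of_sublist (List.tail_sublist _)
  have key : PolyTime fun x => (true :: ((a x).bits ++ (b x).bits)).foldl
      (fun s _ => rippleStep f g s) (a x, b x, false, []) := by
    refine foldl_of_growth (step := fun _ s _ => rippleStep f g s) (by fun_prop) (by fun_prop)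
      (by fun_prop) csize 1 (by simp) (by simp) (.const 10) ?_
    rintro x ⟨a, b, c, o⟩ _ _
    have h1 := hdiv a
    have h2 := hdiv b
    have h3 := csize_bool_le (g a.bodd b.bodd c)
    have h4 := csize_bool_le (f a.bodd b.bodd c)
    simp only [rippleStep, csize_pair, csize_cons]
    omega
  exact key.snd.snd.fst.prodMk key.snd.snd.snd.ofDigits

/-! ### Addition, comparison and subtraction of natural numbers -/

@[fun_prop]
theorem PolyTime.natAdd {f g : X → ℕ} (hf : PolyTime f) (hg : PolyTime g) :
    PolyTime fun x => f x + g x := by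
  have h : PolyTime fun x => (ExpEffect.ripple (fun a b c => Bool.xor a (Bool.xor b c))
      (fun a b c => a && b || a && c || b && c) (f x) (g x)).2 :=
    (ripple (by fun_prop) (by fun_prop) hf hg).snd
  refine h.congr_code fun x => congrArg code ?_
  -- The carry is the majority of the three bits. The final carry vanishes because `f x + g x < 2 ^
  -- k`.
  obtain ⟨k, h1, -, h3⟩ := ripple_spec (ε := 1)
    (f := fun a b c => Bool.xor a (Bool.xor b c)) (g := fun a b c => a && b || a && c || b && c)
    (by decide) (f x) (g x)
  revert h3
  generalize ExpEffect.ripple _ _ (f x) (g x) = r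
  obtain ⟨_ | _, n⟩ := r
  · simp; omega
  · intro h3
    simp only [Bool.toNat_true, one_mul] at h3
    norm_cast at h3
    omega

/-- The result `n` and the final borrow `c` satisfy `a - b = n - 2 ^ k * c` with `0 ≤ n < 2 ^ k`, so
the borrow decides `a < b`, and `n` is the difference if there is no borrow. -/
theorem ripple_sub (a b : ℕ) :
    ripple (fun a b c => Bool.xor a (Bool.xor b c))
      (fun a b c => !a && b || !a && c || b && c) a b = (decide (a < b),
        (ripple (fun a b c => Bool.xor a (Bool.xor b c))
          (fun a b c => !a && b || !a && c || b && c) a b).2) ∧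
    (b ≤ a → (ripple (fun a b c => Bool.xor a (Bool.xor b c))
      (fun a b c => !a && b || !a && c || b && c) a b).2 = a - b) := by
  obtain ⟨k, -, h2, h3⟩ := ripple_spec (ε := -1)
    (f := fun a b c => Bool.xor a (Bool.xor b c)) (g := fun a b c => !a && b || !a && c || b && c)
    (by decide) a b
  revert h2 h3
  generalize ripple _ _ a b = r
  obtain ⟨c, n⟩ := r
  have hk : ((2 ^ k : ℕ) : ℤ) = 2 ^ k := by push_cast; rfl
  rw [← hk]
  generalize 2 ^ k = K
  intro h2 h3
  cases c <;> simp at h2 h3 ⊢ <;> omega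

@[fun_prop]
theorem PolyTime.natLt {f g : X → ℕ} (hf : PolyTime f) (hg : PolyTime g) :
    PolyTime fun x => decide (f x < g x) := by
  have h : PolyTime fun x => (ExpEffect.ripple (fun a b c => Bool.xor a (Bool.xor b c))
      (fun a b c => !a && b || !a && c || b && c) (f x) (g x)).1 :=
    (ripple (by fun_prop) (by fun_prop) hf hg).fst
  exact h.congr_code fun x => by rw [(ripple_sub _ _).1]

@[fun_prop]
theorem PolyTime.natSub {f g : X → ℕ} (hf : PolyTime f) (hg : PolyTime g) :
    PolyTime fun x => f x - g x := by
  have h : PolyTime fun x => (ExpEffect.ripple (fun a b c => Bool.xor a (Bool.xor b c))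
      (fun a b c => !a && b || !a && c || b && c) (f x) (g x)).2 :=
    (ripple (by fun_prop) (by fun_prop) hf hg).snd
  have h' : PolyTime fun x => bif decide (f x < g x) then 0 else
    (ExpEffect.ripple (fun a b c => Bool.xor a (Bool.xor b c))
      (fun a b c => !a && b || !a && c || b && c) (f x) (g x)).2 := by fun_prop
  refine h'.congr_code fun x => congrArg code ?_
  by_cases hlt : f x < g x
  · simp [hlt, hlt.le]
  · simp only [hlt, decide_false, cond_false]
    exact ((ripple_sub _ _).2 (by omega)).symm

/-! ### Multiplication of natural numbers -/

theorem size_add_le (a b : ℕ) : (a + b).size ≤ a.size + b.size + 1 := by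
  rw [Nat.size_le, pow_succ]
  have ha := Nat.lt_size_self a
  have hb := Nat.lt_size_self b
  have h1 : 2 ^ a.size ≤ 2 ^ (a.size + b.size) := Nat.pow_le_pow_right (by norm_num) (by omega)
  have h2 : 2 ^ b.size ≤ 2 ^ (a.size + b.size) := Nat.pow_le_pow_right (by norm_num) (by omega)
  omega

theorem size_mul_le (a b : ℕ) : (a * b).size ≤ a.size + b.size := by
  rw [Nat.size_le, pow_add]
  exact Nat.mul_lt_mul'' (Nat.lt_size_self a) (Nat.lt_size_self b)

@[fun_prop]
theorem PolyTime.natMul {f g : X → ℕ} (hf : PolyTime f) (hg : PolyTime g) :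
    PolyTime fun x => f x * g x := by
  -- Horner's scheme, from the most significant digit on. The crude bound `size_add_le` is enough,
  -- since it adds only the size of `g x` and a constant in each step.
  have h : PolyTime fun x => (f x).bits.reverse.foldl
      (fun n b => Nat.bit false n + bif b then g x else 0) 0 := by
    refine foldl_of_growth (step := fun x n b => Nat.bit false n + bif b then g x else 0)
      (by fun_prop) (by fun_prop) (by fun_prop) Nat.size 4
      (fun s => (csize_nat_le s).trans (by omega)) size_le_csize
      (g := fun x => csize (g x) + 2) (hg.polyBdd.add (.const 2)) ?_
    intro x n b _
    have h1 : (Nat.bit false n).size ≤ n.size + 1 := by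
      rw [Nat.size_le, Nat.bit_false_apply, pow_succ]
      have := Nat.lt_size_self n
      omega
    have h2 := size_le_csize (g x)
    cases b
    · simp only [cond_false, add_zero]; omega
    · have := size_add_le (Nat.bit false n) (g x)
      have h3 : (Nat.bit false n + g x).size ≤ n.size + (csize (g x) + 2) := by omega
      exact h3
  refine h.congr_code fun x => congrArg code ?_
  rw [List.foldl_reverse]
  generalize g x = m
  generalize f x = n
  induction n using Nat.binaryRec' with
  | zero => simp
  | bit b n hn ih =>
    rw [Nat.bits_append_bit n b hn, List.foldr_cons, ← ih, Nat.bit_val, Nat.bit_val]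
    cases b <;> simp <;> ring

theorem csize_natSucc_le (n : ℕ) : (n + 1).size ≤ n.size + 1 := by
  rw [Nat.size_le, pow_succ]
  have := Nat.lt_size_self n
  omega

/-! ### Lengths and indices of lists -/

@[fun_prop]
theorem PolyTime.length {l : X → List α} (hl : PolyTime l) : PolyTime fun x => (l x).length := by
  have h : PolyTime fun x => (l x).foldl (fun n _ => n + 1) 0 :=
    foldl_of_growth (step := fun _ n _ => n + 1) (by fun_prop) hl (by fun_prop) Nat.size 4
      (fun s => (csize_nat_le s).trans (by omega)) size_le_csize (.const 1)
      fun _ n _ _ => csize_natSucc_le n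
  simpa using h

@[fun_prop]
theorem PolyTime.zipIdx {l : X → List α} (hl : PolyTime l) : PolyTime fun x => (l x).zipIdx := by
  let step : ℕ × List ℕ → α → ℕ × List ℕ := fun s _ => (s.1 + 1, s.1 :: s.2)
  have key : ∀ l : List α, l.foldl step (0, []) = (l.length, (List.range l.length).reverse) := by
    intro l
    induction l using List.reverseRecOn with
    | nil => rfl
    | append_singleton l a ih => simp [ih, step, List.range_succ]
  have h : PolyTime fun x => (l x).foldl step (0, []) := by
    refine foldl (step := fun _ => step) (by fun_prop) hl (by fun_prop)
      (B := fun x => (4 * csize (l x) + 1) + (csize (l x) * ((4 * csize (l x) + 1) + 1) + 1) + 1)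
      ?_ fun x l₁ l₂ e => ?_
    · have h1 := hl.polyBdd
      have h2 := ((PolyBdd.const 4).mul h1).add (.const 1)
      exact (h2.add ((h1.mul (h2.add (.const 1))).add (.const 1))).add (.const 1)
    · have h1 : l₁.length ≤ csize (l x) := by
        have := length_le_csize (l x)
        rw [e, List.length_append] at this
        rw [e]; omega
      have h2 : ∀ i ≤ csize (l x), csize i ≤ 4 * csize (l x) + 1 := fun i hi => by
        have h3 : i.size ≤ i := Nat.size_le.2 Nat.lt_two_pow_self
        have := csize_nat_le i
        omega
      rw [key, csize_pair, csize_reverse]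
      have h3 := h2 _ h1
      have h4 : csize (List.range l₁.length) ≤ csize (l x) * ((4 * csize (l x) + 1) + 1) + 1 :=
        csize_list_le (by simpa using h1) fun i hi => h2 i (by simp at hi; omega)
      omega
  have h2 : PolyTime fun x => (l x).zip ((l x).foldl step (0, [])).2.reverse := by fun_prop
  refine h2.congr_code fun x => ?_
  rw [key, List.reverse_reverse, List.zipIdx_eq_zip_range', List.range_eq_range']

/-- The integer with the given sign and absolute value. -/
def signed (s : Bool) (n : ℕ) : ℤ := bif s then -n else n

@[fun_prop]
theorem PolyTime.signed {s : X → Bool} {f : X → ℕ} (hs : PolyTime s) (hf : PolyTime f) :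
    PolyTime fun x => signed (s x) (f x) := by
  -- The sign bit must be suppressed for the value `0`, whose code has no minus sign.
  have h : PolyTime fun x => (s x && decide (0 < f x), f x) := by fun_prop
  refine h.congr_code fun x => ?_
  change Data.node (encBool _) (encNat _) = Data.node (encBool _) (encNat _)
  cases hs : s x
  · have : ¬(f x : ℤ) < 0 := by omega
    simp [ExpEffect.signed, this]
  · simp [ExpEffect.signed]

@[fun_prop]
theorem PolyTime.intSign {f : X → ℤ} (hf : PolyTime f) : PolyTime fun x => decide (f x < 0) :=
  PolyTime.comp (g := fun z : ℤ => decide (z < 0)) (of_fst fun _ => rfl) hf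

@[fun_prop]
theorem PolyTime.natAbs {f : X → ℤ} (hf : PolyTime f) : PolyTime fun x => (f x).natAbs :=
  PolyTime.comp (g := Int.natAbs) (of_snd fun _ => rfl) hf

@[fun_prop]
theorem PolyTime.intNeg {f : X → ℤ} (hf : PolyTime f) : PolyTime fun x => -f x := by
  have h : PolyTime fun x => ExpEffect.signed (!decide (f x < 0)) (f x).natAbs := by fun_prop
  refine h.congr_code fun x => congrArg code ?_
  by_cases h : f x < 0 <;> simp [ExpEffect.signed, h, -Nat.cast_natAbs] <;> omega

@[fun_prop]
theorem PolyTime.intMul {f g : X → ℤ} (hf : PolyTime f) (hg : PolyTime g) :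
    PolyTime fun x => f x * g x := by
  have h : PolyTime fun x => ExpEffect.signed (Bool.xor (decide (f x < 0)) (decide (g x < 0)))
    ((f x).natAbs * (g x).natAbs) := by fun_prop
  refine h.congr_code fun x => congrArg code ?_
  generalize f x = a
  generalize g x = b
  rcases lt_or_ge a 0 with ha | ha <;> rcases lt_or_ge b 0 with hb | hb <;>
    simp [ExpEffect.signed, ha, hb, ha.not_gt, hb.not_gt, abs_of_neg, abs_of_nonneg]

@[fun_prop]
theorem PolyTime.intAdd {f g : X → ℤ} (hf : PolyTime f) (hg : PolyTime g) :
    PolyTime fun x => f x + g x := by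
  have h : PolyTime fun x =>
      bif decide (f x < 0) == decide (g x < 0) then
        ExpEffect.signed (decide (f x < 0)) ((f x).natAbs + (g x).natAbs)
      else bif decide ((f x).natAbs < (g x).natAbs) then
        ExpEffect.signed (decide (g x < 0)) ((g x).natAbs - (f x).natAbs)
      else ExpEffect.signed (decide (f x < 0)) ((f x).natAbs - (g x).natAbs) := by fun_prop
  refine h.congr_code fun x => congrArg code ?_
  generalize f x = a
  generalize g x = b
  rcases lt_or_ge a 0 with ha | ha <;> rcases lt_or_ge b 0 with hb | hb <;>
    rcases lt_or_ge a.natAbs b.natAbs with hab | hab <;>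
    simp [ExpEffect.signed, ha, hb, hab, ha.not_gt, hb.not_gt, hab.not_gt,
      -Nat.cast_natAbs] <;> omega

@[fun_prop]
theorem PolyTime.intSub {f g : X → ℤ} (hf : PolyTime f) (hg : PolyTime g) :
    PolyTime fun x => f x - g x := by
  have h : PolyTime fun x => f x + -g x := by fun_prop
  exact h.congr_code fun x => by rw [sub_eq_add_neg]

@[fun_prop]
theorem PolyTime.intLt {f g : X → ℤ} (hf : PolyTime f) (hg : PolyTime g) :
    PolyTime fun x => decide (f x < g x) := by
  have h : PolyTime fun x => decide (f x - g x < 0) := by fun_prop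
  exact h.congr_code fun x => by simp

instance : PolyTimeEq ℤ :=
  .of_injective (f := fun z : ℤ => (decide (z < 0), z.natAbs)) (by fun_prop) fun a b h => by
    simp only [Prod.mk.injEq, decide_eq_decide] at h
    omega

/-! ### Fractions -/

instance : DecidableEq Frac := fun a b =>
  decidable_of_iff (a.num = b.num ∧ a.den = b.den) <| by
    cases a; cases b; simp

@[fun_prop]
theorem PolyTime.fracNum {f : X → Frac} (hf : PolyTime f) : PolyTime fun x => (f x).num :=
  PolyTime.comp (g := Frac.num) (of_fst fun _ => rfl) hf

@[fun_prop]
theorem PolyTime.fracDen {f : X → Frac} (hf : PolyTime f) : PolyTime fun x => (f x).den :=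
  PolyTime.comp (g := Frac.den) (of_snd fun _ => rfl) hf

theorem PolyTime.fracMk {f g : X → ℤ} (hf : PolyTime f) (hg : PolyTime g) (h : ∀ x, g x ≠ 0) :
    PolyTime fun x => (⟨f x, g x, h x⟩ : Frac) :=
  (hf.prodMk hg).congr_code fun _ => rfl

instance : PolyTimeEq Frac :=
  .of_injective (f := fun q => (q.num, q.den)) (by fun_prop) fun a b h => by
    cases a; cases b; simpa using h

namespace Frac

/-- An integer as a fraction. -/
def ofInt (z : ℤ) : Frac := ⟨z, 1, one_ne_zero⟩

/-- The fraction with numerator `1` and the denominator of the given one. -/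
def unit (q : Frac) : Frac := ⟨1, q.den, q.den_ne_zero⟩

/-- The sum, without reduction to lowest terms. -/
def add (p q : Frac) : Frac :=
  ⟨p.num * q.den + q.num * p.den, p.den * q.den, mul_ne_zero p.den_ne_zero q.den_ne_zero⟩

/-- The product, without reduction to lowest terms. -/
def mul (p q : Frac) : Frac :=
  ⟨p.num * q.num, p.den * q.den, mul_ne_zero p.den_ne_zero q.den_ne_zero⟩

/-- Comparison of values. -/
def ltb (p q : Frac) : Bool :=
  decide (p.num * p.den * (q.den * q.den) < q.num * q.den * (p.den * p.den))

theorem cast_den_ne_zero (q : Frac) : (q.den : ℚ) ≠ 0 := by exact_mod_cast q.den_ne_zero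

theorem val_ofInt (z : ℤ) : (ofInt z).val = z := by simp [ofInt, val]

theorem val_add (p q : Frac) : (p.add q).val = p.val + q.val := by
  have := p.cast_den_ne_zero
  have := q.cast_den_ne_zero
  simp only [add, val]
  push_cast
  field_simp

theorem val_mul (p q : Frac) : (p.mul q).val = p.val * q.val := by
  have := p.cast_den_ne_zero
  have := q.cast_den_ne_zero
  simp only [mul, val]
  push_cast
  field_simp

/-- Denominators may be negative. Both fractions are expanded to the square of their denominator,
which is positive, before cross-multiplication. -/
theorem ltb_iff (p q : Frac) : p.ltb q = true ↔ p.val < q.val := by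
  have hp : (0 : ℚ) < (p.den : ℚ) * p.den := mul_self_pos.2 p.cast_den_ne_zero
  have hq : (0 : ℚ) < (q.den : ℚ) * q.den := mul_self_pos.2 q.cast_den_ne_zero
  have hp' : p.val = (p.num * p.den : ℚ) / (p.den * p.den) := by
    have := p.cast_den_ne_zero
    rw [val]; field_simp
  have hq' : q.val = (q.num * q.den : ℚ) / (q.den * q.den) := by
    have := q.cast_den_ne_zero
    rw [val]; field_simp
  rw [hp', hq', div_lt_div_iff₀ hp hq, ltb, decide_eq_true_eq]
  exact_mod_cast Iff.rfl

/-- The maximal number of digits of numerator and denominator. -/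
def digits (q : Frac) : ℕ := max q.num.natAbs.size q.den.natAbs.size

end Frac

theorem csize_int (z : ℤ) : csize z = csize (decide (z < 0)) + csize z.natAbs + 1 := rfl

theorem csize_frac (q : Frac) : csize q = csize q.num + csize q.den + 1 := rfl

theorem csize_int_le (z : ℤ) : csize z ≤ 4 * z.natAbs.size + 5 := by
  have h1 := csize_nat_le z.natAbs
  have h2 := csize_bool_le (decide (z < 0))
  rw [csize_int]
  omega

theorem size_natAbs_le_csize (z : ℤ) : z.natAbs.size ≤ csize z := by
  have h1 := size_le_csize z.natAbs
  rw [csize_int]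
  omega

theorem csize_frac_le (q : Frac) : csize q ≤ 11 * q.digits + 11 := by
  have h1 := csize_int_le q.num
  have h2 := csize_int_le q.den
  rw [csize_frac, Frac.digits]
  omega

theorem digits_le_csize (q : Frac) : q.digits ≤ csize q := by
  have h1 := size_natAbs_le_csize q.num
  have h2 := size_natAbs_le_csize q.den
  rw [csize_frac, Frac.digits]
  omega

theorem size_natAbs_mul_le (a b : ℤ) :
    (a * b).natAbs.size ≤ a.natAbs.size + b.natAbs.size := by
  rw [Int.natAbs_mul]
  exact size_mul_le _ _

theorem size_add_le_max (a b : ℕ) : (a + b).size ≤ max a.size b.size + 1 := by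
  rw [Nat.size_le, pow_succ]
  have ha := (Nat.lt_size_self a).trans_le
    (Nat.pow_le_pow_right (by norm_num) (le_max_left a.size b.size) : 2 ^ a.size ≤ _)
  have hb := (Nat.lt_size_self b).trans_le
    (Nat.pow_le_pow_right (by norm_num) (le_max_right a.size b.size) : 2 ^ b.size ≤ _)
  omega

/-- The digits grow only additively, so a sum over a whole list stays polynomial without any
reduction to lowest terms. -/
theorem Frac.digits_add_le (p q : Frac) : (p.add q).digits ≤ p.digits + q.digits + 1 := by
  have h1 := size_natAbs_mul_le p.num q.den
  have h2 := size_natAbs_mul_le q.num p.den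
  have h3 := size_natAbs_mul_le p.den q.den
  have h4 := Nat.size_le_size (Int.natAbs_add_le (p.num * q.den) (q.num * p.den))
  have h5 := size_add_le_max (p.num * q.den).natAbs (q.num * p.den).natAbs
  simp only [digits, add]
  omega

theorem Frac.digits_mul_le (p q : Frac) : (p.mul q).digits ≤ p.digits + q.digits := by
  have h1 := size_natAbs_mul_le p.num q.num
  have h3 := size_natAbs_mul_le p.den q.den
  simp only [digits, mul]
  omega

@[fun_prop]
theorem PolyTime.fracOfInt {f : X → ℤ} (hf : PolyTime f) : PolyTime fun x => Frac.ofInt (f x) :=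
  fracMk hf (.const 1) _

@[fun_prop]
theorem PolyTime.fracUnit {f : X → Frac} (hf : PolyTime f) : PolyTime fun x => (f x).unit :=
  fracMk (.const 1) hf.fracDen _

@[fun_prop]
theorem PolyTime.fracAdd {f g : X → Frac} (hf : PolyTime f) (hg : PolyTime g) :
    PolyTime fun x => (f x).add (g x) :=
  fracMk (f := fun x => (f x).num * (g x).den + (g x).num * (f x).den)
    (g := fun x => (f x).den * (g x).den) (by fun_prop) (by fun_prop) _

@[fun_prop]
theorem PolyTime.fracMul {f g : X → Frac} (hf : PolyTime f) (hg : PolyTime g) :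
    PolyTime fun x => (f x).mul (g x) :=
  fracMk (f := fun x => (f x).num * (g x).num) (g := fun x => (f x).den * (g x).den)
    (by fun_prop) (by fun_prop) _

@[fun_prop]
theorem PolyTime.fracLtb {f g : X → Frac} (hf : PolyTime f) (hg : PolyTime g) :
    PolyTime fun x => (f x).ltb (g x) :=
  (by fun_prop : PolyTime fun x => decide ((f x).num * (f x).den * ((g x).den * (g x).den) <
    (g x).num * (g x).den * ((f x).den * (f x).den)))

/-- The sum of a list of fractions. -/
def Frac.sum (l : List Frac) : Frac := l.foldl Frac.add (.ofInt 0)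

theorem Frac.val_sum (l : List Frac) : (Frac.sum l).val = (l.map Frac.val).sum := by
  have : ∀ (l : List Frac) (q : Frac), (l.foldl Frac.add q).val = q.val + (l.map Frac.val).sum := by
    intro l
    induction l with
    | nil => simp
    | cons p l ih => intro q; simp [ih, val_add, add_assoc]
  rw [Frac.sum, this, val_ofInt, Int.cast_zero, zero_add]

@[fun_prop]
theorem PolyTime.fracSum {l : X → List Frac} (hl : PolyTime l) :
    PolyTime fun x => Frac.sum (l x) :=
  foldl_of_growth (step := fun _ => Frac.add) (by fun_prop) hl (by fun_prop) Frac.digits 11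
    csize_frac_le digits_le_csize (g := fun x => csize (l x) + 1) (hl.polyBdd.add (.const 1))
    fun x q a ha => by
      have h1 := Frac.digits_add_le q a
      have h2 := digits_le_csize a
      have h3 := csize_mem_le ha
      omega

/-- The product of a list of fractions. -/
def Frac.prod (l : List Frac) : Frac := l.foldl Frac.mul (.ofInt 1)

theorem Frac.val_prod (l : List Frac) : (Frac.prod l).val = (l.map Frac.val).prod := by
  have : ∀ (l : List Frac) (q : Frac),
      (l.foldl Frac.mul q).val = q.val * (l.map Frac.val).prod := by
    intro l
    induction l with
    | nil => simp
    | cons p l ih => intro q; simp [ih, val_mul, mul_assoc]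
  rw [Frac.prod, this, val_ofInt, Int.cast_one, one_mul]

@[fun_prop]
theorem PolyTime.fracProd {l : X → List Frac} (hl : PolyTime l) :
    PolyTime fun x => Frac.prod (l x) :=
  foldl_of_growth (step := fun _ => Frac.mul) (by fun_prop) hl (by fun_prop) Frac.digits 11
    csize_frac_le digits_le_csize (g := fun x => csize (l x)) hl.polyBdd
    fun x q a ha => by
      have h1 := Frac.digits_mul_le q a
      have h2 := digits_le_csize a
      have h3 := csize_mem_le ha
      omega

/-! #### Common denominators -/

/-- Bring one more fraction to the common denominator (stored as the fraction with numerator `1`) of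
the fractions treated so far. -/
def commonDenStep {ω : Type} (s : Frac × List (ω × ℤ)) (a : ω × Frac) : Frac × List (ω × ℤ) :=
  (s.1.mul a.2.unit, (a.1, a.2.num * s.1.den) :: s.2.map fun t => (t.1, t.2 * a.2.den))

/-- Bring the fractions in the list to a common denominator. -/
def commonDen {ω : Type} (l : List (ω × Frac)) : Frac × List (ω × ℤ) :=
  l.foldl commonDenStep (.ofInt 1, [])

/-- A new fraction multiplies the old numerators and the common denominator by the same number,
which leaves the old values unchanged. The reversal comes from consing. -/
theorem commonDen_spec {ω : Type} (l : List (ω × Frac)) :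
    (commonDen l).1.num = 1 ∧
    (commonDen l).2.map (fun t => (t.1, (commonDen l).1.val * t.2)) =
      l.reverse.map fun a => (a.1, a.2.val) := by
  induction l using List.reverseRecOn with
  | nil => exact ⟨rfl, rfl⟩
  | append_singleton l a ih =>
    obtain ⟨h1, h2⟩ := ih
    have e : commonDen (l ++ [a]) = commonDenStep (commonDen l) a := by
      simp [commonDen, List.foldl_append]
    rw [e]
    generalize commonDen l = s at *
    have h0 := s.1.cast_den_ne_zero
    have ha := a.2.cast_den_ne_zero
    refine ⟨by simp [commonDenStep, Frac.mul, h1, Frac.unit], ?_⟩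
    simp only [commonDenStep, Frac.val_mul, List.map_cons, List.reverse_append,
      List.reverse_singleton, List.singleton_append, List.map_map]
    congr 1
    · simp only [Frac.val, Frac.unit, h1]
      push_cast
      congr 1
      field_simp
    · rw [← h2]
      refine List.map_congr_left fun t _ => ?_
      simp only [Function.comp, Frac.val, Frac.unit, h1]
      push_cast
      congr 1
      field_simp

@[fun_prop]
theorem PolyTime.commonDen {l : X → List (α × Frac)} (hl : PolyTime l) :
    PolyTime fun x => commonDen (l x) := by
  have hstep : PolyTime fun y : X × (Frac × List (α × ℤ)) × (α × Frac) =>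
      commonDenStep y.2.1 y.2.2 := by
    change PolyTime fun y : X × (Frac × List (α × ℤ)) × (α × Frac) =>
      (y.2.1.1.mul y.2.2.2.unit, (y.2.2.1, y.2.2.2.num * y.2.1.1.den) ::
        y.2.1.2.map fun t => (t.1, t.2 * y.2.2.2.den))
    fun_prop
  refine foldl (step := fun _ => commonDenStep) hstep hl (by fun_prop)
    (B := fun x => (11 * (csize (l x) + 1) + 11) + (csize (l x) *
      ((csize (l x) + (4 * (csize (l x) + 1) + 5) + 1) + 1) + 1) + 1) ?_ fun x l₁ l₂ e => ?_
  · have h := hl.polyBdd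
    have h4 := ((PolyBdd.const 4).mul (h.add (.const 1))).add (.const 5)
    have h11 := ((PolyBdd.const 11).mul (h.add (.const 1))).add (.const 11)
    exact (h11.add ((h.mul (((h.add h4).add (.const 1)).add (.const 1))).add
      (.const 1))).add (.const 1)
  -- The common denominator is the product of all denominators, and each new numerator is one old
  -- numerator times the other denominators. Hence the digits are bounded by the size of the list,
  -- up to `1`.
  · have key : ∀ l : List (α × Frac), (ExpEffect.commonDen l).1.digits ≤ csize l + 1 ∧
        (ExpEffect.commonDen l).2.length = l.length ∧
        ∀ t ∈ (ExpEffect.commonDen l).2, csize t.1 ≤ csize l ∧ t.2.natAbs.size ≤ csize l + 1 := by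
      intro l
      induction l using List.reverseRecOn with
      | nil =>
        refine ⟨?_, rfl, by simp [ExpEffect.commonDen]⟩
        have : (Frac.ofInt 1).digits = 1 := by simp [Frac.digits, Frac.ofInt]
        change (Frac.ofInt 1).digits ≤ _
        omega
      | append_singleton l a ih =>
        obtain ⟨h1, h2, h3⟩ := ih
        have e : ExpEffect.commonDen (l ++ [a]) = commonDenStep (ExpEffect.commonDen l) a := by
          simp [ExpEffect.commonDen, List.foldl_append]
        rw [e]
        generalize ExpEffect.commonDen l = s at *
        have h4 := csize_append l [a]
        have h5 := digits_le_csize a.2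
        have h6 : csize [a] = csize a.1 + csize a.2 + 1 + 1 + 1 := rfl
        have h7 := Frac.digits_mul_le s.1 a.2.unit
        have h8 : a.2.unit.digits ≤ csize a.2 := by
          refine max_le ?_ ((le_max_right _ _).trans h5)
          have := one_le_csize a.2
          simpa [Frac.unit] using this
        refine ⟨by change (s.1.mul a.2.unit).digits ≤ _; omega, by simp [commonDenStep, h2], ?_⟩
        simp only [commonDenStep, List.mem_cons, List.mem_map]
        rintro t (rfl | ⟨t, ht, rfl⟩)
        · have h9 := size_natAbs_mul_le a.2.num s.1.den
          have h10 : s.1.den.natAbs.size ≤ s.1.digits := le_max_right _ _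
          have h11 := size_natAbs_le_csize a.2.num
          have h12 := csize_frac a.2
          exact ⟨by simp only; omega, by simp only; omega⟩
        · have h9 := size_natAbs_mul_le t.2 a.2.den
          obtain ⟨h10, h10'⟩ := h3 t ht
          have h11 := size_natAbs_le_csize a.2.den
          have h12 := csize_frac a.2
          exact ⟨by simp only; omega, by simp only; omega⟩
    obtain ⟨h1, h2, h3⟩ := key l₁
    have hl : csize l₁ ≤ csize (l x) := by
      rw [e]; exact csize_le_of_sublist (List.sublist_append_left _ _)
    change csize (ExpEffect.commonDen l₁) ≤ _
    generalize ExpEffect.commonDen l₁ = s at *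
    obtain ⟨q, s⟩ := s
    have h4 := csize_frac_le q
    have h5 := length_le_csize l₁
    have h6 : csize s ≤ csize (l x) * ((csize (l x) + (4 * (csize (l x) + 1) + 5) + 1) + 1) +
        1 := by
      refine csize_list_le (by simp only at h2; omega) fun t ht => ?_
      obtain ⟨t, z⟩ := t
      have h7 := h3 _ ht
      have h8 := csize_int_le z
      simp only at h7
      rw [csize_pair]
      omega
    simp only at h1
    rw [csize_pair]
    omega

/-! ### Weighted lists of states -/

section Weighted
variable {σ ω : Type}

/-- The sum of the values of `f` on the states in the list, with their weights. -/
def total (f : σ → ℚ) (L : List (σ × ℤ)) : ℚ := (L.map fun t => (t.2 : ℚ) * f t.1).sum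

/-- The sum of the absolute values of the weights. -/
def absTotal (L : List (σ × ℤ)) : ℕ := (L.map fun t => t.2.natAbs).sum

theorem size_absTotal_le [Coded σ] (L : List (σ × ℤ)) : (absTotal L).size ≤ csize L := by
  induction L with
  | nil => simp [absTotal]
  | cons t L ih =>
    have h1 := size_add_le t.2.natAbs (absTotal L)
    have h2 := size_natAbs_le_csize t.2
    have h3 : csize (t :: L) = (csize t.1 + csize t.2 + 1) + csize L + 1 := rfl
    change (t.2.natAbs + absTotal L).size ≤ _
    omega

variable (step : σ → ω → σ)

/-- All the successors of weighted states, for the weighted actions in `A`. -/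
def successors (L : List (σ × ℤ)) (A : List (ω × ℤ)) : List (σ × ℤ) :=
  (L.map fun t => A.map fun a => (step t.1 a.1, t.2 * a.2)).flatten

/-- The sum of the values of `G` on all choices of actions, with their weights. -/
def choiceSum {R : Type} [Semiring R] : List (List (ω × R)) → (List ω → R) → R
  | [], G => G []
  | A :: acts, G => (A.map fun a => a.2 * choiceSum acts fun ws => G (a.1 :: ws)).sum

/-- The state `s'` can be reached from `s` by actions from the given lists. -/
def Reaches (acts : List (List (ω × ℤ))) (s s' : σ) : Prop :=
  ∃ ws, List.Forall₂ (fun w A => w ∈ A.map Prod.fst) ws acts ∧ ws.foldl step s = s'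

theorem total_successors (f : σ → ℚ) (L : List (σ × ℤ)) (A : List (ω × ℤ)) :
    total f (successors step L A) =
      total (fun s => (A.map fun a => (a.2 : ℚ) * f (step s a.1)).sum) L := by
  induction L with
  | nil => simp [total, successors]
  | cons t L ih =>
    simp only [total, successors, List.map_cons, List.flatten_cons, List.map_append,
      List.sum_append, List.sum_cons, List.map_map] at ih ⊢
    rw [ih, ← List.sum_map_mul_left]
    congr 2
    refine List.map_congr_left fun a _ => ?_
    simp only [Function.comp]
    push_cast
    ring

/-- The total absolute weight is multiplicative, so its number of digits only adds up over the
columns. -/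
theorem absTotal_successors (L : List (σ × ℤ)) (A : List (ω × ℤ)) :
    absTotal (successors step L A) = absTotal L * absTotal A := by
  induction L with
  | nil => simp [absTotal, successors]
  | cons t L ih =>
    simp only [absTotal, successors, List.map_cons, List.flatten_cons, List.map_append,
      List.sum_append, List.sum_cons, List.map_map] at ih ⊢
    rw [ih, add_mul]
    congr 1
    rw [← List.sum_map_mul_left]
    congr 1
    refine List.map_congr_left fun a _ => ?_
    simp [Int.natAbs_mul]

variable [DecidableEq σ]

/-- Add a weighted state to a list without repeated states. -/
def addWeight (L : List (σ × ℤ)) (t : σ × ℤ) : List (σ × ℤ) :=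
  bif L.any fun r => decide (r.1 = t.1) then
    L.map fun r => (r.1, bif decide (r.1 = t.1) then r.2 + t.2 else r.2)
  else t :: L

/-- As the states in `L` are distinct, the map in `addWeight` changes at most one entry. -/
theorem addWeight_cases {L : List (σ × ℤ)} (hL : (L.map Prod.fst).Nodup) (t : σ × ℤ) :
    (t.1 ∉ L.map Prod.fst ∧ addWeight L t = t :: L) ∨
    ∃ L₁ r L₂, L = L₁ ++ r :: L₂ ∧ r.1 = t.1 ∧ addWeight L t = L₁ ++ (r.1, r.2 + t.2) :: L₂ := by
  by_cases h : ∃ r ∈ L, r.1 = t.1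
  · right
    obtain ⟨r, hr, hrt⟩ := h
    obtain ⟨L₁, L₂, rfl⟩ := List.append_of_mem hr
    refine ⟨L₁, r, L₂, rfl, hrt, ?_⟩
    have hany : ((L₁ ++ r :: L₂).any fun r => decide (r.1 = t.1)) = true := by simp [hrt]
    rw [addWeight, hany, cond_true, List.map_append, List.map_cons]
    have hnd := hL
    simp only [List.map_append, List.map_cons, List.nodup_append, List.nodup_cons] at hnd
    obtain ⟨-, ⟨h2, -⟩, h3⟩ := hnd
    congr 1
    · refine (List.map_congr_left fun s hs => ?_).trans (List.map_id _)
      have : s.1 ≠ t.1 := hrt ▸ h3 _ (List.mem_map_of_mem hs) r.1 (by simp)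
      simp [this]
    · congr 1
      · simp [hrt]
      · refine (List.map_congr_left fun s hs => ?_).trans (List.map_id _)
        have : s.1 ≠ t.1 := fun e => h2 (hrt ▸ e ▸ List.mem_map_of_mem hs)
        simp [this]
  · left
    refine ⟨fun hm => ?_, ?_⟩
    · obtain ⟨r, hr, e⟩ := List.mem_map.1 hm
      exact h ⟨r, hr, e⟩
    · have hany : (L.any fun r => decide (r.1 = t.1)) = false := by
        simpa using fun a b hab e => h ⟨(a, b), hab, e⟩
      rw [addWeight, hany, cond_false]

/-- Merge the entries of a list that belong to the same state. -/
def merge (L : List (σ × ℤ)) : List (σ × ℤ) := L.foldl addWeight []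

/-- All clauses follow from the case distinction for one inserted entry; the one on `absTotal` is
the triangle inequality. -/
theorem merge_spec (L : List (σ × ℤ)) :
    ((merge L).map Prod.fst).Nodup ∧ (∀ s ∈ (merge L).map Prod.fst, s ∈ L.map Prod.fst) ∧
    absTotal (merge L) ≤ absTotal L ∧ (merge L).length ≤ L.length ∧
    ∀ f : σ → ℚ, total f (merge L) = total f L := by
  induction L using List.reverseRecOn with
  | nil => simp [merge]
  | append_singleton L t ih =>
    obtain ⟨h1, h2, h3, h4, h5⟩ := ih
    have e : merge (L ++ [t]) = addWeight (merge L) t := by simp [merge, List.foldl_append]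
    rw [e]
    rcases addWeight_cases h1 t with ⟨hn, e'⟩ | ⟨L₁, r, L₂, e₁, hrt, e'⟩
    · rw [e']
      refine ⟨by simpa using ⟨by simpa using hn, h1⟩, ?_, ?_, by simpa using h4, fun f => ?_⟩
      · simp only [List.map_cons, List.mem_cons, List.map_append, List.mem_append]
        rintro s (rfl | hs)
        · simp
        · exact Or.inl (h2 s hs)
      · simp only [absTotal, List.map_cons, List.sum_cons, List.map_append, List.sum_append,
          List.map_nil, List.sum_nil] at h3 ⊢
        omega
      · have := h5 f
        simp only [total, List.map_cons, List.sum_cons, List.map_append, List.sum_append,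
          List.map_nil, List.sum_nil] at this ⊢
        rw [this]; ring
    · have hk : (addWeight (merge L) t).map Prod.fst = (merge L).map Prod.fst := by
        rw [e', e₁]; simp
      refine ⟨hk ▸ h1, fun s hs => ?_, ?_, ?_, fun f => ?_⟩
      · rw [hk] at hs
        rw [List.map_append]
        exact List.mem_append_left _ (h2 s hs)
      · rw [e']
        rw [e₁] at h3
        simp only [absTotal, List.map_cons, List.sum_cons, List.map_append, List.sum_append,
          List.map_nil, List.sum_nil] at h3 ⊢
        have := Int.natAbs_add_le r.2 t.2
        omega
      · rw [e']
        rw [e₁] at h4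
        simp only [List.length_append, List.length_cons, List.length_nil] at h4 ⊢
        omega
      · have := h5 f
        rw [e']
        rw [e₁] at this
        simp only [total, List.map_cons, List.sum_cons, List.map_append, List.sum_append,
          List.map_nil, List.sum_nil] at this ⊢
        push_cast
        rw [← this, hrt]; ring

/-- The distribution (up to a factor) of the final state, if the state `s` is changed by actions
chosen independently from the given lists. -/
def finalStates (acts : List (List (ω × ℤ))) (s : σ) : List (σ × ℤ) :=
  acts.foldl (fun L A => merge (successors step L A)) [(s, 1)]

/-- Correctness of the dynamic program. Reading one list of actions from `L` amounts to replacing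
the test function by its weighted sum over these actions, and merging does not affect totals. -/
theorem total_foldl_successors (f : σ → ℚ) (acts : List (List (ω × ℤ))) (L : List (σ × ℤ)) :
    total f (acts.foldl (fun L A => merge (successors step L A)) L) =
      total (fun s => choiceSum (acts.map fun A => A.map fun a => (a.1, (a.2 : ℚ)))
        fun ws => f (ws.foldl step s)) L := by
  induction acts generalizing L with
  | nil => rfl
  | cons A acts ih =>
    rw [List.foldl_cons, ih, (merge_spec _).2.2.2.2, total_successors]
    simp only [List.map_cons, choiceSum, List.map_map, List.foldl_cons]
    rfl

theorem total_finalStates (f : σ → ℚ) (acts : List (List (ω × ℤ))) (s : σ) :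
    total f (finalStates step acts s) =
      choiceSum (acts.map fun A => A.map fun a => (a.1, (a.2 : ℚ)))
        fun ws => f (ws.foldl step s) := by
  rw [finalStates, total_foldl_successors]
  simp [total]

theorem finalStates_append (acts : List (List (ω × ℤ))) (A : List (ω × ℤ)) (s : σ) :
    finalStates step (acts ++ [A]) s = merge (successors step (finalStates step acts s) A) := by
  simp [finalStates, List.foldl_append]

theorem nodup_finalStates (acts : List (List (ω × ℤ))) (s : σ) :
    ((finalStates step acts s).map Prod.fst).Nodup := by
  induction acts using List.reverseRecOn with
  | nil => simp [finalStates]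
  | append_singleton acts A ih => rw [finalStates_append]; exact (merge_spec _).1

theorem reaches_of_mem {acts : List (List (ω × ℤ))} {s s' : σ}
    (h : s' ∈ (finalStates step acts s).map Prod.fst) : Reaches step acts s s' := by
  induction acts using List.reverseRecOn generalizing s' with
  | nil =>
    have : s' = s := by simpa [finalStates] using h
    exact ⟨[], .nil, by simp [this]⟩
  | append_singleton acts A ih =>
    rw [finalStates_append] at h
    have := (merge_spec _).2.1 _ h
    simp only [successors, List.mem_map, List.mem_flatten, exists_exists_and_eq_and] at this
    obtain ⟨r, ⟨t, ht, a, ha, rfl⟩, rfl⟩ := this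
    obtain ⟨ws, h1, h2⟩ := ih (List.mem_map_of_mem ht)
    exact ⟨ws ++ [a.1], List.rel_append h1 (.cons (List.mem_map_of_mem ha) .nil), by
      simp [List.foldl_append, h2]⟩

/-- This keeps the integer weights short. Merging cannot increase the total absolute weight, and the
digits of a product are at most the sum of the digits of its factors. -/
theorem size_absTotal_finalStates [Coded ω] (acts : List (List (ω × ℤ))) (s : σ) :
    (absTotal (finalStates step acts s)).size ≤ csize acts := by
  induction acts using List.reverseRecOn with
  | nil => simp [finalStates, absTotal, csize_nil]
  | append_singleton acts A ih =>
    rw [finalStates_append]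
    have h1 := Nat.size_le_size
      ((merge_spec (successors step (finalStates step acts s) A)).2.2.1)
    rw [absTotal_successors] at h1
    have h2 := size_mul_le (absTotal (finalStates step acts s)) (absTotal A)
    have h3 := size_absTotal_le A
    have h4 := csize_append acts [A]
    have h5 : csize [A] = csize A + 1 + 1 := rfl
    omega

end Weighted

theorem natAbs_le_absTotal {σ : Type} {L : List (σ × ℤ)} {t : σ × ℤ} (h : t ∈ L) :
    t.2.natAbs ≤ absTotal L := by
  obtain ⟨L₁, L₂, rfl⟩ := List.append_of_mem h
  simp only [absTotal, List.map_append, List.map_cons, List.sum_append, List.sum_cons]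
  omega

@[fun_prop]
theorem PolyTime.merge [DecidableEq α] [PolyTimeEq α] {L : X → List (α × ℤ)} (hL : PolyTime L) :
    PolyTime fun x => merge (L x) := by
  have hstep : PolyTime fun y : X × List (α × ℤ) × (α × ℤ) => addWeight y.2.1 y.2.2 := by
    change PolyTime fun y : X × List (α × ℤ) × (α × ℤ) =>
      bif y.2.1.any fun r => decide (r.1 = y.2.2.1) then
        y.2.1.map fun r => (r.1, bif decide (r.1 = y.2.2.1) then r.2 + y.2.2.2 else r.2)
      else y.2.2 :: y.2.1
    fun_prop
  refine foldl (step := fun _ => addWeight) hstep hL (by fun_prop)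
    (B := fun x => csize (L x) * ((csize (L x) + (4 * csize (L x) + 5) + 1) + 1) + 1)
    ?_ fun x l₁ l₂ e => ?_
  · have h := hL.polyBdd
    have h4 := ((PolyBdd.const 4).mul h).add (.const 5)
    exact (h.mul (((h.add h4).add (.const 1)).add (.const 1))).add (.const 1)
  · obtain ⟨-, h2, h3, h4, -⟩ := merge_spec l₁
    change csize (ExpEffect.merge l₁) ≤ _
    have hl : csize l₁ ≤ csize (L x) := by
      rw [e]; exact csize_le_of_sublist (List.sublist_append_left _ _)
    refine csize_list_le (by have := length_le_csize l₁; omega) fun t ht => ?_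
    have h5 := Nat.size_le_size ((natAbs_le_absTotal ht).trans h3)
    have h6 := size_absTotal_le l₁
    have h7 := csize_int_le t.2
    have h8 : csize t.1 ≤ csize l₁ := by
      obtain ⟨r, hr, e⟩ := List.mem_map.1 (h2 t.1 (List.mem_map_of_mem ht))
      rw [← e]
      refine le_trans ?_ (csize_mem_le hr)
      change _ ≤ csize r.1 + csize r.2 + 1
      omega
    change csize t.1 + csize t.2 + 1 ≤ _
    omega

/-- The distribution of the final state is computable in polynomial time, if the number and the
sizes of the reachable states are polynomially bounded. -/
theorem PolyTime.finalStates [DecidableEq α] [PolyTimeEq α] {step : α → β → α}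
    (hstep : PolyTime fun y : α × β => step y.1 y.2) {acts : X → List (List (β × ℤ))}
    (hacts : PolyTime acts) {s : X → α} (hs : PolyTime s) {N B : X → ℕ} (hN : PolyBdd N)
    (hB : PolyBdd B)
    (hcard : ∀ x l₁ l₂, acts x = l₁ ++ l₂ → ∀ K : List α, K.Nodup →
      (∀ s' ∈ K, Reaches step l₁ (s x) s') → K.length ≤ N x)
    (hsize : ∀ x l₁ l₂, acts x = l₁ ++ l₂ → ∀ s', Reaches step l₁ (s x) s' → csize s' ≤ B x) :
    PolyTime fun x => finalStates step (acts x) (s x) := by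
  have hsucc : PolyTime fun y : X × List (α × ℤ) × List (β × ℤ) =>
      ExpEffect.merge (successors step y.2.1 y.2.2) := by
    have : PolyTime fun y : X × List (α × ℤ) × List (β × ℤ) =>
      (y.2.1.map fun t => y.2.2.map fun a => (step t.1 a.1, t.2 * a.2)).flatten := by fun_prop
    exact this.merge
  -- After merging, there are at most `N x` entries, each with a state of size at most `B x` and a
  -- weight of at most `csize (acts x)` digits. The hypotheses speak of all prefixes because every
  -- intermediate list has to be bounded.
  refine foldl (step := fun _ L A => ExpEffect.merge (successors step L A)) hsucc hacts
    (by fun_prop) (B := fun x => N x * ((B x + (4 * csize (acts x) + 5) + 1) + 1) + 1)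
    ?_ fun x l₁ l₂ e => ?_
  · have h4 := ((PolyBdd.const 4).mul hacts.polyBdd).add (.const 5)
    exact (hN.mul (((hB.add h4).add (.const 1)).add (.const 1))).add (.const 1)
  · change csize (ExpEffect.finalStates step l₁ (s x)) ≤ _
    refine csize_list_le ?_ fun t ht => ?_
    · have := hcard x l₁ l₂ e _ (nodup_finalStates step l₁ (s x)) fun s' => reaches_of_mem step
      simpa using this
    · have h1 := hsize x l₁ l₂ e t.1 (reaches_of_mem step (List.mem_map_of_mem ht))
      have h2 := Nat.size_le_size (natAbs_le_absTotal ht)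
      have h3 := size_absTotal_finalStates step l₁ (s x)
      have h4 := csize_int_le t.2
      have hl : csize l₁ ≤ csize (acts x) := by
        rw [e]; exact csize_le_of_sublist (List.sublist_append_left _ _)
      change csize t.1 + csize t.2 + 1 ≤ _
      omega

/-! ### Encoded inputs -/

theorem encList_map {α β : Type} (f : β → Data) (g : α → β) (l : List α) :
    encList f (l.map g) = encList (fun a => f (g a)) l := by
  induction l with
  | nil => rfl
  | cons a l ih => simp [encList, ih]

theorem encList_injective {α : Type} {f : α → Data} (hf : f.Injective) :
    (encList f).Injective := by
  intro l
  induction l with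
  | nil => rintro (_ | ⟨b, l'⟩) h <;> simp_all [encList]
  | cons a l ih =>
    rintro (_ | ⟨b, l'⟩) h
    · simp [encList] at h
    · simp only [encList, Data.node.injEq] at h
      rw [hf h.1, ih h.2]

theorem encNat_injective : encNat.Injective := by
  intro a b h
  have : Function.Injective encBool := by
    rintro (_ | _) (_ | _) h <;> simp_all [encBool]
  rw [← foldr_bit_bits a, encList_injective this h, foldr_bit_bits]

theorem encPerm_injective {n : ℕ} : (encPerm (n := n)).Injective := by
  intro π π' h
  have h1 : encList encNat (List.ofFn fun i => (π i : ℕ)) =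
      encList encNat (List.ofFn fun i => (π' i : ℕ)) := by
    have e : ∀ π : Equiv.Perm (Fin n),
        (List.ofFn fun i => (π i : ℕ)) = (List.ofFn π).map (fun i : Fin n => (i : ℕ)) := by
      intro π; rw [List.map_ofFn]; rfl
    rw [e, e, encList_map, encList_map]
    exact h
  have h2 := List.ofFn_injective (encList_injective encNat_injective h1)
  ext i
  exact congrFun h2 i

instance (F : Format) : Coded F.Rep := ⟨F.enc⟩

instance : Coded (Σ n, Equiv.Perm (Fin n)) := ⟨fun π => encPerm π.2⟩

/-- The list of the rows of a matrix. -/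
def rowList {α : Type} {n m : ℕ} (A : Matrix (Fin n) (Fin m) α) : List (List α) :=
  List.ofFn fun i => List.ofFn fun j => A i j

/-- The list of the columns of a matrix. -/
def colList {α : Type} {n m : ℕ} (A : Matrix (Fin n) (Fin m) α) : List (List α) :=
  List.ofFn fun j => List.ofFn fun i => A i j

theorem code_rowList {n m : ℕ} (A : Matrix (Fin n) (Fin m) α) :
    code (rowList A) = encMatrix code A := by
  have : rowList A =
      (List.ofFn fun i => (fun j => A i j : Fin m → α)).map fun v => List.ofFn v := by
    rw [List.map_ofFn]; rfl
  rw [this]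
  exact encList_map _ _ _

theorem rowList_map {α β : Type} {n m : ℕ} (A : Matrix (Fin n) (Fin m) α) (f : α → β) :
    (rowList A).map (List.map f) = rowList (A.map f) := by
  simp only [rowList, List.map_ofFn, Function.comp_def]
  rfl

/-- The inputs of the problem. -/
structure Input (F : Format) (S : ℕ → ℕ → Prop) where
  n : ℕ
  m : ℕ
  dim : S n m
  mat : Matrix (Fin n) (Fin m) F.Rep
  dist : Fin m → Dist F
  par : List ℕ

variable {F : Format} {S : ℕ → ℕ → Prop}

instance : Coded (Input F S) := ⟨fun x => encInput x.mat x.dist x.par⟩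

namespace Input

/-- The lists of value-probability pairs. -/
def pairs (x : Input F S) : List (List (F.Rep × Frac)) := List.ofFn fun j => (x.dist j).pairs

theorem code_eq (x : Input F S) : code x = code (rowList x.mat, x.pairs, x.par) := by
  change encInput _ _ _ = Data.node (code (rowList x.mat)) (.node (code x.pairs) _)
  rw [code_rowList]
  have : x.pairs = (List.ofFn x.dist).map fun D => D.pairs := by rw [List.map_ofFn]; rfl
  have h : code x.pairs = encVec encDist x.dist := by
    rw [this]
    exact encList_map _ _ _
  rw [h]
  rfl

theorem polyTime_parts : PolyTime fun x : Input F S => (rowList x.mat, x.pairs, x.par) :=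
  PolyTime.of_code_eq fun x => (code_eq x).symm

@[fun_prop]
theorem polyTime_rowList : PolyTime fun x : Input F S => rowList x.mat :=
  polyTime_parts.fst

@[fun_prop]
theorem polyTime_pairs : PolyTime fun x : Input F S => x.pairs :=
  polyTime_parts.snd.fst

@[fun_prop]
theorem polyTime_par : PolyTime fun x : Input F S => x.par :=
  polyTime_parts.snd.snd

end Input

theorem expPolyTime_of_polyTime {r : Ranking} {e : Effect} {f : Input F S → Frac}
    (hf : PolyTime f)
    (h : ∀ x, (f x).val = expectedEffect r e (x.mat.map F.val) x.dist x.par) :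
    ExpPolyTime F r e S := by
  obtain ⟨p, b, hp⟩ := hf
  exact ⟨p, b, fun n m hS M D a => ⟨_, h ⟨n, m, hS, M, D, a⟩, hp ⟨n, m, hS, M, D, a⟩⟩⟩

/-! #### Columns -/

/-- The columns of the matrix with the given rows, each one together with an entry of a list. -/
def withColumns {γ : Type} : List γ → List (List Frac) → List (List Frac × γ)
  | [], _ => []
  | d :: l, rows =>
    (rows.map fun row => row.headD (.ofInt 0), d) :: withColumns l (rows.map List.tail)

/-- The recursion follows the list of the `d j`, since a matrix without rows does not show how many
columns it has. The default entry does not occur here, as every row has an entry left for each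
remaining `d j`. -/
theorem withColumns_ofFn {γ : Type} {n m : ℕ} (d : Fin m → γ) (A : Matrix (Fin n) (Fin m) Frac) :
    withColumns (List.ofFn d) (rowList A) =
      List.ofFn fun j => (List.ofFn fun i => A i j, d j) := by
  induction m with
  | zero => rfl
  | succ m ih =>
    have h := ih (fun j => d j.succ) (Matrix.of fun i j => A i j.succ)
    have h1 : (rowList A).map List.tail = rowList (Matrix.of fun i j => A i (Fin.succ j)) := by
      simp [rowList, List.map_ofFn, Function.comp_def, List.ofFn_succ]
    have h2 : (rowList A).map (fun row => row.headD (.ofInt 0)) = List.ofFn fun i => A i 0 := by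
      simp [rowList, List.map_ofFn, Function.comp_def, List.ofFn_succ]
    rw [List.ofFn_succ, withColumns, h1, h, h2, List.ofFn_succ]
    rfl

theorem csize_map_le {c : ℕ} {f : α → β} (l : List α) (h : ∀ a ∈ l, csize (f a) ≤ csize a + c) :
    csize (l.map f) ≤ csize l + l.length * c := by
  induction l with
  | nil => simp [csize_nil]
  | cons a l ih =>
    have h1 := ih fun b hb => h b (by simp [hb])
    have h2 := h a (by simp)
    simp only [List.map_cons, csize_cons, List.length_cons, add_mul]
    omega

@[fun_prop]
theorem PolyTime.withColumns {l : X → List γ} {rows : X → List (List Frac)} (hl : PolyTime l)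
    (hr : PolyTime rows) : PolyTime fun x => withColumns (l x) (rows x) := by
  let step : List (List Frac) × List (List Frac × γ) → γ →
      List (List Frac) × List (List Frac × γ) := fun s d =>
    (s.1.map List.tail, (s.1.map fun row => row.headD (.ofInt 0), d) :: s.2)
  have hstep : PolyTime fun y : X × (List (List Frac) × List (List Frac × γ)) × γ =>
      step y.2.1 y.2.2 := by
    change PolyTime fun y : X × (List (List Frac) × List (List Frac × γ)) × γ =>
      (y.2.1.1.map List.tail,
        (y.2.1.1.map fun row => row.headD (.ofInt 0), y.2.2) :: y.2.1.2)
    have : PolyTime fun y : X × (List (List Frac) × List (List Frac × γ)) × γ =>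
      y.2.1.1.map fun row => row.tail := by fun_prop
    fun_prop
  have spec : ∀ (l : List γ) (rows : List (List Frac)) (acc : List (List Frac × γ)),
      (l.foldl step (rows, acc)).2.reverse = acc.reverse ++ ExpEffect.withColumns l rows := by
    intro l
    induction l with
    | nil => simp [ExpEffect.withColumns]
    | cons d l ih =>
      intro rows acc
      rw [List.foldl_cons]
      change (l.foldl step (rows.map List.tail, (_, d) :: acc)).2.reverse = _
      rw [ih, List.reverse_cons, List.append_assoc]
      rfl
  have key : PolyTime fun x => (l x).foldl step (rows x, []) := by
    -- The rows only shrink, and a list of heads exceeds the size of the rows by at most one default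
    -- entry per row.
    refine foldl (step := fun _ => step) hstep hl (by fun_prop)
      (B := fun x => csize (rows x) + (csize (l x) * ((csize (rows x) +
        csize (rows x) * csize (Frac.ofInt 0)) + csize (l x) + 1 + 1) + 1) + 1) ?_
      fun x l₁ l₂ e => ?_
    · have h1 := hl.polyBdd
      have h2 := hr.polyBdd
      exact (h2.add ((h1.mul ((((h2.add (h2.mul (.const _))).add h1).add (.const 1)).add
        (.const 1))).add (.const 1))).add (.const 1)
    · have h : ∀ (k : List γ), (∀ d ∈ k, d ∈ l x) →
          csize (k.foldl step (rows x, [])).1 ≤ csize (rows x) ∧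
          (k.foldl step (rows x, [])).1.length = (rows x).length ∧
          (k.foldl step (rows x, [])).2.length = k.length ∧
          ∀ t ∈ (k.foldl step (rows x, [])).2, csize t ≤ (csize (rows x) +
            csize (rows x) * csize (Frac.ofInt 0)) + csize (l x) + 1 := by
        intro k
        induction k using List.reverseRecOn with
        | nil => simp
        | append_singleton k d ih =>
          intro hk
          obtain ⟨h1, h2, h3, h4⟩ := ih fun d hd => hk d (by simp [hd])
          rw [List.foldl_append, List.foldl_cons, List.foldl_nil]
          generalize k.foldl step (rows x, []) = s at *
          obtain ⟨rem, acc⟩ := s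
          simp only [step] at *
          refine ⟨?_, by simpa using h2, by simpa using h3, ?_⟩
          · have := csize_map_le (c := 0) (f := List.tail) rem fun r _ =>
              csize_le_of_sublist (List.tail_sublist r)
            omega
          · intro t ht
            rcases List.mem_cons.1 ht with rfl | ht
            · have h5 := csize_map_le (c := csize (Frac.ofInt 0))
                (f := fun row : List Frac => row.headD (.ofInt 0)) rem fun r _ => by
                  cases r with
                  | nil => exact Nat.le_add_left _ _
                  | cons a r => simp only [List.headD_cons, csize_cons]; omega
              have h6 := csize_mem_le (hk d (by simp))
              have h7 := Nat.mul_le_mul_right (csize (Frac.ofInt 0)) (length_le_csize (rows x))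
              rw [h2] at h5
              rw [csize_pair]
              omega
            · exact h4 t ht
      obtain ⟨h1, -, h3, h4⟩ := h l₁ fun d hd => by rw [e]; simp [hd]
      generalize l₁.foldl step (rows x, []) = s at *
      have h5 : csize l₁ ≤ csize (l x) := by
        rw [e]; exact csize_le_of_sublist (List.sublist_append_left _ _)
      have h6 := length_le_csize l₁
      have h7 := csize_list_le (h3.trans_le (h6.trans h5)) h4
      change csize s.1 + csize s.2 + 1 ≤ _
      omega
  have h2 := key.snd.reverse
  simpa [spec] using h2

/-! #### Expectations as sums over choices -/

/-- The sum over all choices is split into the choice for the first column and those for the others.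
The hypothesis on `f` quantifies over representations `v`, because actions are computed from
representations and not from values. -/
theorem expectation_eq_choiceSum {ω : Type} {m : ℕ} (D : Fin m → Dist F)
    (f : (Fin m → ℚ) → ℚ) (act : Fin m → F.Rep → ω) (G : List ω → ℚ)
    (h : ∀ v : Fin m → F.Rep, f (fun j => F.val (v j)) = G (List.ofFn fun j => act j (v j))) :
    expectation D f =
      choiceSum (List.ofFn fun j => (D j).pairs.map fun p => (act j p.1, p.2.val)) G := by
  induction m generalizing G with
  | zero =>
    have h0 := h fun j => j.elim0
    simp only [expectation, choiceSum, List.ofFn_zero] at h0 ⊢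
    rw [← h0]
    simp
    congr
    ext j; exact j.elim0
  | succ m ih =>
    rw [List.ofFn_succ, choiceSum, expectation, ← (Fin.consEquiv _).sum_comp, Fintype.sum_prod_type,
      List.map_map, ← Fin.sum_univ_fun_getElem]
    refine Finset.sum_congr rfl fun c _ => ?_
    simp only [Function.comp]
    rw [← ih (fun j => D j.succ)
      (fun u => f (Fin.cons (F.val (D 0).pairs[(c : ℕ)].1) u)) (fun j => act j.succ)
      (fun ws => G (act 0 (D 0).pairs[(c : ℕ)].1 :: ws)) ?_, expectation, Finset.mul_sum]
    · refine Finset.sum_congr rfl fun c' _ => ?_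
      rw [Fin.prod_univ_succ, mul_assoc]
      congr 2
      congr 1
      ext j
      refine Fin.cases ?_ (fun j => ?_) j <;> rfl
    · intro v
      have := h (Fin.cons (D 0).pairs[(c : ℕ)].1 v)
      rw [List.ofFn_succ] at this
      simp only [Fin.cons_zero, Fin.cons_succ] at this
      rw [← this]
      congr 1
      ext j
      refine Fin.cases ?_ (fun j => ?_) j <;> rfl

/-- The weighted sum is linear in the weights of each column, so each common denominator can be
pulled out. -/
theorem choiceSum_commonDen {ω : Type} (l : List (List (ω × Frac))) (G : List ω → ℚ) :
    choiceSum (l.map fun A => A.map fun a => (a.1, a.2.val)) G =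
      choiceSum (l.map fun A => (commonDen A).2.map fun a => (a.1, (a.2 : ℚ))) G *
        (l.map fun A => (commonDen A).1.val).prod := by
  induction l generalizing G with
  | nil => simp [choiceSum]
  | cons A l ih =>
    simp only [List.map_cons, choiceSum, List.prod_cons, ih]
    rw [← List.sum_reverse, ← List.map_reverse, ← List.map_reverse, ← (commonDen_spec A).2,
      List.map_map, List.map_map, ← List.sum_map_mul_right]
    congr 1
    refine List.map_congr_left fun a _ => ?_
    simp only [Function.comp]
    ring

/-! ### Expected effects by dynamic programming -/

/-- A consequence of determinism. It is used to show that a ranking computed from the state does not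
depend on the matrix that led to the state. -/
theorem PolyTime.code_eq {f : α → β} (hf : PolyTime f) {x y : α} (h : code x = code y) :
    code (f x) = code (f y) := by
  obtain ⟨p, b, hp⟩ := hf
  obtain ⟨t, ht, -⟩ := hp x
  obtain ⟨s, hs, -⟩ := hp y
  rw [h] at ht
  exact (ht.deterministic hs).1

namespace Input
variable (φ : F.Rep → Frac)

/-- For each column, the possible results of scaling it, with integral weights over a common
denominator. -/
def scaled (x : Input F S) : List (Frac × List (List Frac × ℤ)) :=
  (withColumns x.pairs ((rowList x.mat).map (List.map φ))).map fun c =>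
    commonDen (c.2.map fun p => (c.1.map fun q => q.mul (φ p.1), p.2))

/-- The possible results of scaling each column, with their weights. -/
def actions (x : Input F S) : List (List (List Frac × ℤ)) := (x.scaled φ).map Prod.snd

/-- The possible results of scaling each column, with their probabilities. -/
def outcomes (x : Input F S) : List (List (List Frac × Frac)) :=
  List.ofFn fun j => (x.dist j).pairs.map fun p =>
    (List.ofFn fun i => (φ (x.mat i j)).mul (φ p.1), p.2)

theorem scaled_eq (x : Input F S) : x.scaled φ = (x.outcomes φ).map commonDen := by
  rw [scaled, rowList_map, pairs, withColumns_ofFn, outcomes, List.map_ofFn, List.map_ofFn]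
  simp [Function.comp_def, List.map_ofFn]

theorem actions_eq (x : Input F S) :
    x.actions φ = (x.outcomes φ).map fun A => (commonDen A).2 := by
  rw [actions, scaled_eq, List.map_map]
  rfl

theorem length_actions (x : Input F S) : (x.actions φ).length = x.m := by
  simp [actions_eq, outcomes]

/-- The list is one of the possible results of scaling the column `j`. -/
def IsScaledColumn (x : Input F S) (j : Fin x.m) (w : List Frac) : Prop :=
  ∃ p ∈ (x.dist j).pairs, w = List.ofFn fun i => (φ (x.mat i j)).mul (φ p.1)

theorem map_fst_commonDen {ω : Type} (l : List (ω × Frac)) :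
    (commonDen l).2.map Prod.fst = (l.map Prod.fst).reverse := by
  have := congrArg (List.map Prod.fst) (commonDen_spec l).2
  simpa [List.map_map, Function.comp_def, List.map_reverse] using this

theorem isScaledColumn_of_mem {x : Input F S} {j : ℕ} (hj : j < (x.actions φ).length)
    {w : List Frac} (hw : w ∈ (x.actions φ)[j].map Prod.fst) :
    x.IsScaledColumn φ ⟨j, by rwa [← length_actions φ]⟩ w := by
  simp only [actions_eq, outcomes, List.getElem_map, List.getElem_ofFn, map_fst_commonDen,
    List.mem_reverse, List.map_map, List.mem_map, Function.comp] at hw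
  obtain ⟨p, hp, rfl⟩ := hw
  exact ⟨p, hp, rfl⟩

/-- A choice of actions yields a matrix. -/
theorem exists_matrix_of_forall₂ {x : Input F S} {ws : List (List Frac)}
    (h : List.Forall₂ (fun w A => w ∈ A.map Prod.fst) ws (x.actions φ)) :
    ∃ A : Matrix (Fin x.n) (Fin x.m) Frac, ws = colList A := by
  obtain ⟨hlen, h⟩ := List.forall₂_iff_get.1 h
  have hm : ws.length = x.m := hlen.trans (length_actions φ x)
  have hcol : ∀ (j : ℕ) (hj : j < ws.length), ws[j].length = x.n := fun j hj => by
    obtain ⟨p, -, hp⟩ := isScaledColumn_of_mem φ (hlen ▸ hj) (h j hj (hlen ▸ hj))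
    have := congrArg List.length hp
    simpa using this
  refine ⟨Matrix.of fun i j => (ws[(j : ℕ)]'(by omega))[(i : ℕ)]'(by rw [hcol]; omega), ?_⟩
  refine List.ext_getElem (by simp [colList, hm]) fun j h1 h2 => ?_
  refine List.ext_getElem (by simp [colList, hcol]) fun i h3 h4 => ?_
  simp [colList]

variable {φ}

theorem polyTime_scaled (hφ : PolyTime φ) : PolyTime fun x : Input F S => x.scaled φ := by
  have h1 : PolyTime fun x : Input F S => (rowList x.mat).map fun row => row.map φ := by fun_prop
  change PolyTime fun x : Input F S =>
    (withColumns x.pairs ((rowList x.mat).map fun row => row.map φ)).map fun c =>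
      commonDen (c.2.map fun p => (c.1.map fun q => q.mul (φ p.1), p.2))
  fun_prop

theorem polyTime_actions (hφ : PolyTime φ) : PolyTime fun x : Input F S => x.actions φ := by
  have := polyTime_scaled (S := S) hφ
  change PolyTime fun x : Input F S => (x.scaled φ).map fun t => t.2
  fun_prop

theorem polyTime_colList (hφ : PolyTime φ) :
    PolyTime fun x : Input F S => colList (x.mat.map φ) := by
  have h1 : PolyTime fun x : Input F S =>
    (withColumns x.pairs ((rowList x.mat).map fun row => row.map φ)).map fun t => t.1 := by fun_prop
  refine h1.congr_code fun x => ?_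
  change _ = code (((withColumns x.pairs ((rowList x.mat).map (List.map φ))).map fun t => t.1))
  rw [rowList_map, pairs, withColumns_ofFn, List.map_ofFn]
  rfl

end Input

/-! ### From bounded state spaces to expected effects -/

section States
variable {κ : Type} [Coded κ]

/-- An input together with a scaled matrix, given by the state reached on its columns. -/
structure StateInput (F : Format) (S : ℕ → ℕ → Prop) (step : List κ → List Frac → List κ)
    (k₀ : κ) where
  input : Input F S
  mat : Matrix (Fin input.n) (Fin input.m) Frac

variable {step : List κ → List Frac → List κ} {k₀ : κ}

/-- The state reached on the columns of the matrix. -/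
def StateInput.state (y : StateInput F S step k₀) : List κ :=
  (colList y.mat).foldl step (List.replicate y.input.n k₀)

/-- The scaled matrix is left out of the code on purpose: polynomial time on this type means
computability from the input and the state alone. -/
instance : Coded (StateInput F S step k₀) := ⟨fun y => code (y.input, y.state)⟩

/-- The arguments of an effect function. -/
structure EffectInput where
  n : ℕ
  par : List ℕ
  orig : Equiv.Perm (Fin n)
  new : Equiv.Perm (Fin n)

instance : Coded EffectInput :=
  ⟨fun y => .node (encList encNat y.par) (.node (encPerm y.orig) (encPerm y.new))⟩

theorem csize_le_of_forall₂ {ws : List α} {acts : List (List (α × β))}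
    (h : List.Forall₂ (fun w A => w ∈ A.map Prod.fst) ws acts) : csize ws ≤ csize acts := by
  induction h with
  | nil => rfl
  | @cons w A ws acts h _ ih =>
    obtain ⟨a, ha, rfl⟩ := List.mem_map.1 h
    have h1 := csize_mem_le ha
    have h2 : csize a = csize a.1 + csize a.2 + 1 := rfl
    rw [csize_cons, csize_cons]
    omega

/-- The dynamic program for an arbitrary notion of state. By the choice of codes, `hr` says that the
state suffices for computing the ranking; `hcard` bounds the number of states after every prefix of
the columns. The expectation is the sum of weight times effect over the final states, times the
product of the common denominators' reciprocals. -/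
theorem expPolyTime_of_states [DecidableEq κ] [PolyTimeEq κ] {r : Ranking} {e : Effect}
    {φ : F.Rep → Frac} (hφ : PolyTime φ) (hφv : ∀ z, (φ z).val = F.val z) (he : PolyTimeEffect e)
    (hstep : PolyTime fun y : List κ × List Frac => step y.1 y.2)
    (hr : PolyTime fun y : StateInput F S step k₀ =>
      (⟨_, r _ _ (y.mat.map Frac.val)⟩ : Σ n, Equiv.Perm (Fin n)))
    (hsize : PolyBdd fun y : List Unit × List (List Frac) =>
      csize (y.2.foldl step (List.replicate y.1.length k₀)))
    {N : Input F S → ℕ} (hN : PolyBdd N)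
    (hcard : ∀ (x : Input F S) l₁ l₂, x.actions φ = l₁ ++ l₂ → ∀ K : List (List κ), K.Nodup →
      (∀ s ∈ K, Reaches step l₁ (List.replicate x.n k₀) s) → K.length ≤ N x) :
    ExpPolyTime F r e S := by
  obtain ⟨b, hb⟩ := hsize
  -- A list of `n` units stands for `n` in unary. It lets `hsize` apply both to the columns of the
  -- original matrix and to any choice of scaled columns.
  have hunits : PolyTime fun x : Input F S => List.replicate x.n () := by
    have : PolyTime fun x : Input F S => (rowList x.mat).map fun _ => () := by fun_prop
    exact this.congr_code fun x => by
      rw [List.map_const', rowList, List.length_ofFn]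
  have hinit : PolyTime fun x : Input F S => List.replicate x.n k₀ := by
    have : PolyTime fun x : Input F S => (rowList x.mat).map fun _ => k₀ := by fun_prop
    exact this.congr_code fun x => by
      rw [List.map_const', rowList, List.length_ofFn]
  have hbdd : ∀ {l : Input F S → List (List Frac)}, PolyTime l →
      PolyBdd fun x => b.eval (csize (List.replicate x.n (), l x)) := fun hl =>
    PolyBdd.comp (g := fun y : List Unit × List (List Frac) => b.eval (csize y))
      ⟨b, fun _ => le_rfl⟩ (hunits.prodMk hl)
  have hstate : ∀ (x : Input F S) (l : List (List Frac)) (k : ℕ), csize l ≤ k →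
      csize (l.foldl step (List.replicate x.n k₀)) ≤
        b.eval (csize (List.replicate x.n ()) + k + 1) := fun x l k hk => by
    have : csize (l.foldl step (List.replicate (List.replicate x.n ()).length k₀)) ≤ _ :=
      hb (List.replicate x.n (), l)
    rw [List.length_replicate] at this
    exact this.trans (eval_mono b (by rw [csize_pair]; omega))
  -- the original ranking
  have horig : PolyTime fun x : Input F S =>
      (⟨x, x.mat.map φ⟩ : StateInput F S step k₀) := by
    have h1 := Input.polyTime_colList (S := S) hφ
    have h2 : PolyTime fun x : Input F S =>
        (colList (x.mat.map φ)).foldl step (List.replicate x.n k₀) :=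
      PolyTime.foldl (step := fun _ => step)
        (hstep.comp (f := fun y : Input F S × List κ × List Frac => y.2) (by fun_prop)) h1 hinit
        (hbdd h1) fun x l₁ l₂ e => (hstate x l₁ (csize (colList (x.mat.map φ)))
          (by rw [e]; exact csize_le_of_sublist (List.sublist_append_left _ _))).trans
            (by rw [csize_pair])
    exact (PolyTime.id'.prodMk h2).congr_code fun x => rfl
  -- the distribution of the final state
  have hacts := Input.polyTime_actions (S := S) hφ
  have hfinal : PolyTime fun x : Input F S =>
      finalStates step (x.actions φ) (List.replicate x.n k₀) := by
    refine PolyTime.finalStates hstep hacts hinit hN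
      (B := fun x => b.eval (csize (List.replicate x.n ()) + csize (x.actions φ) + 1)) ?_ hcard ?_
    · exact PolyBdd.comp (g := fun y : List Unit × List (List (List Frac × ℤ)) => b.eval (csize y))
        ⟨b, fun _ => le_rfl⟩ (hunits.prodMk hacts)
    · rintro x l₁ l₂ e s' ⟨ws, hws, rfl⟩
      refine hstate x ws _ ((csize_le_of_forall₂ hws).trans ?_)
      rw [e]; exact csize_le_of_sublist (List.sublist_append_left _ _)
  -- the effect
  obtain ⟨p, c, hp⟩ := he
  choose q hq hrun using hp
  let effect : EffectInput → Frac := fun y => q y.n y.par y.orig y.new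
  have heffect : PolyTime effect := ⟨p, c, fun y => hrun y.n y.par y.orig y.new⟩
  let arg : StateInput F S step k₀ → EffectInput := fun y =>
    ⟨y.input.n, y.input.par, r _ _ ((y.input.mat.map φ).map Frac.val),
      r _ _ (y.mat.map Frac.val)⟩
  have harg : PolyTime arg := by
    have h1 : PolyTime fun y : StateInput F S step k₀ => y.input :=
      PolyTime.fst (f := fun y : StateInput F S step k₀ => (y.input, y.state))
        (PolyTime.of_code_eq fun _ => rfl)
    have h2 := hr.comp (horig.comp h1)
    exact ((Input.polyTime_par.comp h1).prodMk (h2.prodMk hr)).congr_code fun _ => rfl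
  have harg_eq : ∀ (x : Input F S) (A A' : Matrix (Fin x.n) (Fin x.m) Frac),
      (⟨x, A⟩ : StateInput F S step k₀).state = (⟨x, A'⟩ : StateInput F S step k₀).state →
      arg ⟨x, A⟩ = arg ⟨x, A'⟩ := fun x A A' h => by
    have h1 := hr.code_eq (x := ⟨x, A⟩) (y := ⟨x, A'⟩) (congrArg (fun s => code (x, s)) h)
    have h2 : r _ _ (A.map Frac.val) = r _ _ (A'.map Frac.val) := encPerm_injective h1
    simp only [arg, h2]
  -- The effect at a state is that of an arbitrarily chosen matrix leading to it; by `harg_eq` the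
  -- choice is immaterial. The value `0` on unreachable lists is never used.
  let valAt : Input F S → List κ → Frac := by
    classical
    exact fun x s => if h : ∃ A : Matrix (Fin x.n) (Fin x.m) Frac,
        s = (⟨x, A⟩ : StateInput F S step k₀).state then effect (arg ⟨x, h.choose⟩) else .ofInt 0
  have hvalAt : ∀ (x : Input F S) (A : Matrix (Fin x.n) (Fin x.m) Frac),
      valAt x (⟨x, A⟩ : StateInput F S step k₀).state = effect (arg ⟨x, A⟩) := fun x A => by
    have h : ∃ A' : Matrix (Fin x.n) (Fin x.m) Frac, (⟨x, A⟩ : StateInput F S step k₀).state =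
        (⟨x, A'⟩ : StateInput F S step k₀).state := ⟨A, rfl⟩
    simp only [valAt, dif_pos h]
    rw [harg_eq x _ _ h.choose_spec.symm]
  -- The promise under which `valAt` is computable: the effect program is specified only on codes of
  -- genuine permutations, so the state must come from a matrix.
  let I : Input F S × (List κ × ℤ) → Prop := fun y =>
    ∃ A : Matrix (Fin y.1.n) (Fin y.1.m) Frac, y.2.1 = (⟨y.1, A⟩ : StateInput F S step k₀).state
  have hpolyVal : PolyTime fun y : {y // I y} => valAt y.1.1 y.1.2.1 := by
    have h1 : PolyTime fun y : {y // I y} =>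
        (⟨y.1.1, y.2.choose⟩ : StateInput F S step k₀) := by
      have : PolyTime fun y : {y // I y} => (y.1.1, y.1.2.1) := by fun_prop
      exact this.congr_code fun y => congrArg (fun s => code (y.1.1, s)) y.2.choose_spec.symm
    refine (heffect.comp (harg.comp h1)).congr_code fun y => ?_
    rw [← hvalAt, ← y.2.choose_spec]
  have hmem : ∀ x : Input F S, ∀ t ∈ finalStates step (x.actions φ) (List.replicate x.n k₀),
      I (x, t) := fun x t ht => by
    obtain ⟨ws, h1, h2⟩ := reaches_of_mem step (List.mem_map_of_mem ht)
    obtain ⟨A, rfl⟩ := Input.exists_matrix_of_forall₂ φ h1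
    exact ⟨A, h2.symm⟩
  have hsum : PolyTime fun x : Input F S =>
      (finalStates step (x.actions φ) (List.replicate x.n k₀)).map
        fun t => (Frac.ofInt t.2).mul (valAt x t.1) := by
    refine PolyTime.map_of_inv (f := fun x t => (Frac.ofInt t.2).mul (valAt x t.1)) I ?_ hfinal hmem
    have h1 : PolyTime fun y : {y // I y} => Frac.ofInt y.1.2.2 := by fun_prop
    exact h1.fracMul hpolyVal
  have hscaled := Input.polyTime_scaled (S := S) hφ
  -- The first components are the reciprocals of the common denominators.
  have hprod : PolyTime fun x : Input F S => Frac.prod ((x.scaled φ).map fun t => t.1) := by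
    fun_prop
  refine expPolyTime_of_polyTime (hsum.fracSum.fracMul hprod) fun x => ?_
  rw [Frac.val_mul, Frac.val_sum, Frac.val_prod, List.map_map, List.map_map]
  have h1 : (List.map (Frac.val ∘ fun t : List κ × ℤ => (Frac.ofInt t.2).mul (valAt x t.1))
      (finalStates step (x.actions φ) (List.replicate x.n k₀))).sum =
      total (fun s => (valAt x s).val)
        (finalStates step (x.actions φ) (List.replicate x.n k₀)) := by
    simp only [total, Function.comp_def, Frac.val_mul, Frac.val_ofInt]
  rw [h1, total_finalStates, Input.actions_eq, Input.scaled_eq, List.map_map, List.map_map]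
  have h2 := choiceSum_commonDen (x.outcomes φ)
    fun ws => (valAt x (ws.foldl step (List.replicate x.n k₀))).val
  simp only [Function.comp_def]
  rw [← h2, expectedEffect]
  symm
  have h3 : ((x.outcomes φ).map fun A => A.map fun a => (a.1, a.2.val)) =
      List.ofFn fun j => (x.dist j).pairs.map fun p =>
        (List.ofFn fun i => (φ (x.mat i j)).mul (φ p.1), p.2.val) := by
    simp [Input.outcomes, List.map_ofFn, Function.comp_def]
  rw [h3]
  refine expectation_eq_choiceSum x.dist _
    (fun j z => List.ofFn fun i => (φ (x.mat i j)).mul (φ z)) _ fun v => ?_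
  have h4 := hvalAt x (Matrix.of fun i j => (φ (x.mat i j)).mul (φ (v j)))
  change valAt x (List.foldl step (List.replicate x.n k₀) (List.ofFn fun j => List.ofFn fun i =>
    (φ (x.mat i j)).mul (φ (v j)))) = _ at h4
  rw [h4]
  change _ = (q _ _ _ _).val
  rw [hq]
  have h5 : (x.mat.map φ).map Frac.val = x.mat.map F.val := by ext i j; simp [hφv]
  have h6 : (Matrix.of fun i j => (φ (x.mat i j)).mul (φ (v j))).map Frac.val =
      scaleColumns (x.mat.map F.val) fun j => F.val (v j) := by
    ext i j; simp [scaleColumns, Frac.val_mul, hφv]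
  have h7 : e x.n x.par (r x.n x.m ((x.mat.map φ).map Frac.val)) (r x.n x.m
      ((Matrix.of fun i j => (φ (x.mat i j)).mul (φ (v j))).map Frac.val)) =
      e x.n x.par (r x.n x.m (x.mat.map F.val))
        (r x.n x.m (scaleColumns (x.mat.map F.val) fun j => F.val (v j))) := by rw [h5, h6]
  exact h7.symm

end States

/-! ### Entrywise state updates -/

section Entrywise
variable {κ : Type}

/-- Update each entry of the state with the corresponding entry of the column. -/
def entrywise (g : κ → Frac → κ) (s : List κ) (w : List Frac) : List κ :=
  (s.zip w).map fun p => g p.1 p.2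

theorem zip_ofFn {α β : Type} {n : ℕ} (f : Fin n → α) (g : Fin n → β) :
    (List.ofFn f).zip (List.ofFn g) = List.ofFn fun i => (f i, g i) :=
  List.ext_getElem (by simp) fun i h1 h2 => by simp

theorem foldl_entrywise (g : κ → Frac → κ) {n m : ℕ} (s : Fin n → κ)
    (A : Matrix (Fin n) (Fin m) Frac) :
    (colList A).foldl (entrywise g) (List.ofFn s) =
      List.ofFn fun i => (List.ofFn fun j => A i j).foldl g (s i) := by
  induction m generalizing s with
  | zero => simp [colList]
  | succ m ih =>
    have h1 : colList A = (List.ofFn fun i => A i 0) ::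
        colList (Matrix.of fun i j => A i (Fin.succ j)) := by
      rw [colList, List.ofFn_succ]; rfl
    have h2 : entrywise g (List.ofFn s) (List.ofFn fun i => A i 0) =
        List.ofFn fun i => g (s i) (A i 0) := by
      rw [entrywise, zip_ofFn, List.map_ofFn]; rfl
    rw [h1, List.foldl_cons, h2, ih]
    congr 1
    ext1 i
    rw [List.ofFn_succ, List.foldl_cons]
    rfl

theorem replicate_eq_ofFn (n : ℕ) (k : κ) : List.replicate n k = List.ofFn fun _ : Fin n => k := by
  rw [List.ofFn_const]

variable [Coded κ]

theorem polyTime_entrywise {g : κ → Frac → κ}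
    (hg : PolyTime fun y : κ × Frac => g y.1 y.2) :
    PolyTime fun y : List κ × List Frac => entrywise g y.1 y.2 := by
  have : Inhabited Frac := ⟨.ofInt 0⟩
  change PolyTime fun y : List κ × List Frac => (y.1.zip y.2).map fun p => g p.1 p.2
  fun_prop

/-- The sum of `μ k + 1` over the state grows by at most `c` times the size of the column read,
hence linearly in the size of all columns. -/
theorem polyBdd_foldl_entrywise {g : κ → Frac → κ} (k₀ : κ) (μ : κ → ℕ) (c : ℕ)
    (h1 : ∀ k, csize k ≤ c * μ k + c) (h2 : ∀ k a, μ (g k a) ≤ μ k + c * csize a) :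
    PolyBdd fun y : List Unit × List (List Frac) =>
      csize (y.2.foldl (entrywise g) (List.replicate y.1.length k₀)) := by
  let M : List κ → ℕ := fun s => (s.map fun k => μ k + 1).sum
  have hM : ∀ s, csize s ≤ (c + 1) * M s + 1 := fun s => by
    induction s with
    | nil => simp [csize_nil]
    | cons k s ih =>
      have := h1 k
      simp only [csize_cons, M, List.map_cons, List.sum_cons] at ih ⊢
      nlinarith
  have hstep : ∀ s w, M (entrywise g s w) ≤ M s + c * csize w := by
    intro s
    induction s with
    | nil => intro w; simp [entrywise, M]
    | cons k s ih =>
      rintro (_ | ⟨a, w⟩)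
      · simp [entrywise, M]
      · have h3 := ih w
        have h4 := h2 k a
        simp only [M, entrywise, List.zip_cons_cons, List.map_cons, List.sum_cons,
          csize_cons] at h3 ⊢
        nlinarith
  have hfold : ∀ (ws : List (List Frac)) (s : List κ),
      M (ws.foldl (entrywise g) s) ≤ M s + c * csize ws := by
    intro ws
    induction ws with
    | nil => simp
    | cons w ws ih =>
      intro s
      have h3 := ih (entrywise g s w)
      have h4 := hstep s w
      rw [List.foldl_cons, csize_cons]
      nlinarith
  have hfst : PolyTime fun y : List Unit × List (List Frac) => y.1 := by fun_prop
  have hsnd : PolyTime fun y : List Unit × List (List Frac) => y.2 := by fun_prop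
  refine PolyBdd.of_le (h := fun y => (c + 1) * (csize y.1 * (μ k₀ + 1) + c * csize y.2) + 1)
    (((PolyBdd.const (c + 1)).mul ((hfst.polyBdd.mul (.const _)).add
      ((PolyBdd.const c).mul hsnd.polyBdd))).add (.const 1)) fun y => ?_
  have h3 := hfold y.2 (List.replicate y.1.length k₀)
  have h4 : M (List.replicate y.1.length k₀) = y.1.length * (μ k₀ + 1) := by
    simp [M, List.map_replicate, List.sum_replicate, mul_add]
  have h5 := Nat.mul_le_mul_right (μ k₀ + 1) (length_le_csize y.1)
  exact (hM _).trans (Nat.succ_le_succ (Nat.mul_le_mul_left _ (by omega)))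

end Entrywise

/-! ### A bounded number of columns -/

theorem length_sections {α : Type} (L : List (List α)) :
    L.sections.length = (L.map List.length).prod := by
  induction L with
  | nil => rfl
  | cons l L ih =>
    simp [List.sections, List.length_flatMap, ih, mul_comm]

/-- Distinct states come from distinct choices of actions, and these are the sections of the lists
of actions. -/
theorem length_le_of_reaches {σ ω : Type} {step : σ → ω → σ} {acts : List (List (ω × ℤ))} {s : σ}
    {K : List σ} (hK : K.Nodup) (h : ∀ s' ∈ K, Reaches step acts s s') :
    K.length ≤ (acts.map List.length).prod := by
  have hsub : K ⊆ ((acts.map (List.map Prod.fst)).sections).map fun ws => ws.foldl step s := by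
    intro s' hs'
    obtain ⟨ws, h1, rfl⟩ := h s' hs'
    refine List.mem_map_of_mem (List.mem_sections.2 ?_)
    rw [List.forall₂_map_right_iff]
    exact h1
  have := (hK.subperm hsub).length_le
  simpa [length_sections, List.map_map, Function.comp_def] using this

instance : Coded (Σ n m, Matrix (Fin n) (Fin m) Frac) := ⟨fun A => encMatrix encFrac A.2.2⟩

/-- The step appends each entry of the column to its row, so the final state is the scaled matrix
itself and the program for `r` can be run on it. -/
theorem expPolyTime_of_cols_le {r : Ranking} {e : Effect} (hr : PolyTimeRanking r)
    (he : PolyTimeEffect e) (c : ℕ) : ExpPolyTime binaryRat r e fun _ m => m ≤ c := by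
  have hg : PolyTime fun y : List Frac × Frac => y.1 ++ [y.2] := by fun_prop
  have hφ : PolyTime (id : Frac → Frac) := by exact PolyTime.id'
  have hacts := Input.polyTime_actions (F := binaryRat) (S := fun _ m => m ≤ c) (φ := id) hφ
  refine expPolyTime_of_states (F := binaryRat) (φ := id) hφ (fun _ => rfl) he
    (step := entrywise fun k a => k ++ [a]) (k₀ := []) (polyTime_entrywise hg) ?_
    (polyBdd_foldl_entrywise [] csize 2 (fun k => by omega) fun k a => ?_)
    (N := fun x => csize (x.actions id) ^ c) (hacts.polyBdd.pow c) ?_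
  · obtain ⟨p, b, hp⟩ := hr
    have h1 : PolyTime fun A : Σ n m, Matrix (Fin n) (Fin m) Frac =>
        (⟨_, r _ _ (A.2.2.map Frac.val)⟩ : Σ n, Equiv.Perm (Fin n)) :=
      ⟨p, b, fun A => hp _ _ A.2.2⟩
    have h2 : PolyTime fun y : StateInput binaryRat (fun _ m => m ≤ c)
        (entrywise fun (k : List Frac) a => k ++ [a]) [] =>
        (⟨_, _, y.mat⟩ : Σ n m, Matrix (Fin n) (Fin m) Frac) := by
      have h3 : PolyTime fun y : StateInput binaryRat (fun _ m => m ≤ c)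
          (entrywise fun (k : List Frac) a => k ++ [a]) [] => y.state :=
        PolyTime.of_snd fun _ => rfl
      refine h3.congr_code fun y => ?_
      have h4 : y.state = rowList y.mat := by
        rw [StateInput.state, replicate_eq_ofFn, foldl_entrywise, rowList]
        congr 1
        ext1 i
        have : ∀ l l' : List Frac, l.foldl (fun k a => k ++ [a]) l' = l' ++ l := by
          intro l
          induction l with
          | nil => simp
          | cons a l ih => intro l'; rw [List.foldl_cons, ih]; simp
        rw [this]; rfl
      rw [h4, code_rowList]
      rfl
    exact h1.comp h2
  · have h1 := csize_append k [a]
    have h2 : csize [a] = csize a + 1 + 1 := rfl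
    have h3 := one_le_csize a
    omega
  · intro x l₁ l₂ e K hK h
    refine (length_le_of_reaches hK h).trans ?_
    -- Each factor is the number of actions of one column, and a prefix has at most `m ≤ c` columns.
    have h1 : (l₁.map List.length).prod ≤ csize (x.actions id) ^ (l₁.map List.length).length := by
      refine List.prod_le_pow_card _ _ ?_
      simp only [List.mem_map, forall_exists_index, and_imp, forall_apply_eq_imp_iff₂]
      intro A hA
      exact (length_le_csize A).trans (csize_mem_le (by rw [e]; simp [hA]))
    refine h1.trans (Nat.pow_le_pow_right (one_le_csize _) ?_)
    have h2 := Input.length_actions id x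
    have h3 := x.dim
    rw [e, List.length_append] at h2
    rw [List.length_map]
    omega

/-! ### A bounded number of rows -/

section Rank
variable {κ : Type}

/-- The positions of the entries of a list in the increasing order, ties being broken by the
index. -/
def rankList (lt : κ → κ → Bool) (l : List κ) : List ℕ :=
  l.zipIdx.map fun p =>
    (l.zipIdx.filter fun q => lt q.1 p.1 || (!lt p.1 q.1 && decide (q.2 < p.2))).length

theorem polyTime_rankList [Coded κ] {lt : κ → κ → Bool}
    (hlt : PolyTime fun y : κ × κ => lt y.1 y.2) : PolyTime (rankList lt) := by
  change PolyTime fun l : List κ => l.zipIdx.map fun p =>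
    (l.zipIdx.filter fun q => lt q.1 p.1 || (!lt p.1 q.1 && decide (q.2 < p.2))).length
  fun_prop

theorem length_filter_ofFn {α : Type} {n : ℕ} (f : Fin n → α) (p : α → Bool) :
    ((List.ofFn f).filter p).length = (Finset.univ.filter fun i => p (f i) = true).card := by
  induction n with
  | zero => simp
  | succ n ih =>
    rw [List.ofFn_succ, List.filter_cons, Fin.card_filter_univ_succ, ← ih]
    split_ifs <;> simp

theorem card_filter_perm_lt {n : ℕ} (π : Equiv.Perm (Fin n)) (i : Fin n) :
    (Finset.univ.filter fun j => π j < π i).card = π i := by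
  have : (Finset.univ.filter fun j => π j < π i).map π.toEmbedding = Finset.Iio (π i) := by
    ext j
    simp only [Finset.mem_map, Finset.mem_filter, Finset.mem_univ, true_and, Finset.mem_Iio]
    exact ⟨fun ⟨k, hk, e⟩ => e ▸ hk, fun h => ⟨π.symm j, by simpa using h, by simp⟩⟩
  rw [← Finset.card_map π.toEmbedding, this, Fin.card_Iio]

theorem eq_iff_eq_of_lt_iff_lt {K K' ι : Type} [LinearOrder K] [LinearOrder K'] {k : ι → K}
    {k' : ι → K'} (h : ∀ i j, k i < k j ↔ k' i < k' j) (i j : ι) : k i = k j ↔ k' i = k' j := by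
  rw [le_antisymm_iff, le_antisymm_iff, ← not_lt, ← not_lt, ← not_lt, ← not_lt, h, h]

/-- A row's position is the number of rows before it, so only the strict order of the keys matters.
This allows ranking by levels in place of whole rows. -/
theorem rankBy_congr {K K' : Type} [LinearOrder K] [LinearOrder K'] {n : ℕ} {k : Fin n → K}
    {k' : Fin n → K'} (h : ∀ i j, k i < k j ↔ k' i < k' j) : rankBy k = rankBy k' := by
  have h1 : ∀ i j, rankBy k i < rankBy k j ↔ rankBy k' i < rankBy k' j := fun i j => by
    rw [rankBy_lt_iff, rankBy_lt_iff, h, eq_iff_eq_of_lt_iff_lt h]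
  ext i
  rw [← card_filter_perm_lt (rankBy k) i, ← card_filter_perm_lt (rankBy k') i]
  simp only [h1]

theorem rankList_ofFn {K : Type} [LinearOrder K] {lt : κ → κ → Bool} {v : κ → K}
    (h : ∀ a b, lt a b = true ↔ v a < v b) {n : ℕ} (k : Fin n → κ) :
    rankList lt (List.ofFn k) = List.ofFn fun i => (rankBy (fun i => v (k i)) i : ℕ) := by
  have h1 : (List.ofFn k).zipIdx = List.ofFn fun i => (k i, (i : ℕ)) :=
    List.ext_getElem (by simp) fun i h1 h2 => by simp
  rw [rankList, h1, List.map_ofFn]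
  congr 1
  ext1 i
  rw [Function.comp, length_filter_ofFn, ← card_filter_perm_lt]
  congr 1
  ext j
  have e : v (k j) = v (k i) ↔ ¬v (k j) < v (k i) ∧ ¬v (k i) < v (k j) := by
    rw [not_lt, not_lt, le_antisymm_iff, and_comm]
  simp only [Finset.mem_filter, Finset.mem_univ, true_and, rankBy_lt_iff, Bool.or_eq_true,
    Bool.and_eq_true, Bool.not_eq_true', decide_eq_true_eq, h, ← Bool.not_eq_true]
  rw [e, Fin.lt_def (a := j)]
  tauto

theorem code_rankBy {K : Type} [LinearOrder K] {n : ℕ} (k : Fin n → K) :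
    code (List.ofFn fun i => (rankBy k i : ℕ)) = encPerm (rankBy k) := by
  have e : (List.ofFn fun i => (rankBy k i : ℕ)) =
      (List.ofFn (rankBy k)).map fun i : Fin n => (i : ℕ) := by rw [List.map_ofFn]; rfl
  rw [e]
  exact encList_map _ _ _

variable [Coded κ] [DecidableEq κ] [PolyTimeEq κ] {step : List κ → List Frac → List κ} {k₀ : κ}

/-- States that consist of one key for each row, which are finally used for ranking. -/
theorem expPolyTime_of_keys {K : Type} [LinearOrder K] {r : Ranking} {e : Effect}
    {φ : F.Rep → Frac} (hφ : PolyTime φ) (hφv : ∀ z, (φ z).val = F.val z) (he : PolyTimeEffect e)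
    (c : ℕ) (hstep : PolyTime fun y : List κ × List Frac => step y.1 y.2)
    (hsize : PolyBdd fun y : List Unit × List (List Frac) =>
      csize (y.2.foldl step (List.replicate y.1.length k₀)))
    {lt : κ → κ → Bool} (hlt : PolyTime fun y : κ × κ => lt y.1 y.2) {v : κ → K}
    (hv : ∀ a b, lt a b = true ↔ v a < v b)
    (hr : ∀ (n m : ℕ) (A : Matrix (Fin n) (Fin m) Frac), ∃ k : Fin n → κ,
      (colList A).foldl step (List.replicate n k₀) = List.ofFn k ∧
      rankBy (fun i => v (k i)) = r n m (A.map Frac.val))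
    (hlen : ∀ s w, s.length = w.length → (step s w).length = s.length)
    {N : Input F (fun n _ => n ≤ c) → ℕ} (hN : PolyBdd N)
    (hT : ∀ x : Input F fun n _ => n ≤ c, ∃ T : Finset κ, T.card ≤ N x ∧
      ∀ ws : List (List Frac), ws.length ≤ x.m →
        (∀ w ∈ ws, ∃ A ∈ x.actions φ, w ∈ A.map Prod.fst) →
        ∀ k ∈ ws.foldl step (List.replicate x.n k₀), k ∈ T) :
    ExpPolyTime F r e fun n _ => n ≤ c := by
  -- A state is an `n`-tuple of keys from a set of at most `N x` elements. The `+ 1` makes the base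
  -- positive, so that the exponent `n` can be raised to `c`.
  refine expPolyTime_of_states hφ hφv he hstep ?_ hsize
    (N := fun x => (N x + 1) ^ c) ((hN.add (.const 1)).pow c) ?_
  · have h1 : PolyTime fun y : StateInput F (fun n _ => n ≤ c) step k₀ => y.state :=
      PolyTime.of_snd fun _ => rfl
    refine ((polyTime_rankList hlt).comp h1).congr_code fun y => ?_
    obtain ⟨k, hk, hkr⟩ := hr _ _ y.mat
    rw [StateInput.state, hk, rankList_ofFn hv, code_rankBy, hkr]
    rfl
  · intro x l₁ l₂ e K hK h
    obtain ⟨T, hTN, hT⟩ := hT x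
    have hsub : K ⊆ (List.replicate x.n T.toList).sections := by
      intro s hs
      obtain ⟨ws, h1, rfl⟩ := h s hs
      have hmem : ∀ w ∈ ws, ∃ A ∈ x.actions φ, w ∈ A.map Prod.fst := by
        intro w hw
        obtain ⟨i, hi, rfl⟩ := List.mem_iff_getElem.1 hw
        obtain ⟨hl, h2⟩ := List.forall₂_iff_get.1 h1
        exact ⟨l₁[i], by rw [e]; simp, h2 i hi (hl ▸ hi)⟩
      have hws : ws.length ≤ x.m := by
        have := Input.length_actions φ x
        rw [e, List.length_append, ← h1.length_eq] at this
        omega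
      -- The state keeps exactly one key per row, because every chosen column has length `n`.
      have hl : (ws.foldl step (List.replicate x.n k₀)).length = x.n := by
        have : ∀ (ws : List (List Frac)) (s : List κ), s.length = x.n →
            (∀ w ∈ ws, w.length = x.n) → (ws.foldl step s).length = x.n := by
          intro ws
          induction ws with
          | nil => intro s hs _; simpa using hs
          | cons w ws ih =>
            intro s hs hw
            refine ih _ ?_ fun w hw' => hw w (by simp [hw'])
            rw [hlen _ _ (by rw [hs, hw w (by simp)]), hs]
        refine this ws _ (by simp) fun w hw => ?_
        obtain ⟨A, hA, hwA⟩ := hmem w hw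
        obtain ⟨j, hj, rfl⟩ := List.mem_iff_getElem.1 hA
        obtain ⟨p, -, rfl⟩ := Input.isScaledColumn_of_mem φ hj hwA
        simp
      refine List.mem_sections.2 (List.forall₂_iff_get.2 ⟨by simp [hl], fun i h3 h4 => ?_⟩)
      have := hT ws hws hmem _ (List.get_mem _ ⟨i, h3⟩)
      simpa using this
    have h1 := (hK.subperm hsub).length_le
    rw [length_sections, List.map_replicate, List.prod_replicate, Finset.length_toList] at h1
    refine h1.trans ((Nat.pow_le_pow_left (hTN.trans (Nat.le_succ _)) _).trans ?_)
    exact Nat.pow_le_pow_right (Nat.succ_pos _) x.dim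

end Rank

theorem length_entrywise {κ : Type} (g : κ → Frac → κ) (s : List κ) (w : List Frac)
    (h : s.length = w.length) : (entrywise g s w).length = s.length := by
  simp [entrywise, h]

/-- The index in `P` counts the columns read, for bounds that grow with every column, as those on
partial sums do. -/
theorem foldl_entrywise_induction {κ : Type} {g : κ → Frac → κ} {P : ℕ → κ → Prop}
    {ws : List (List Frac)} (hg : ∀ i k, ∀ w ∈ ws, ∀ a ∈ w, P i k → P (i + 1) (g k a))
    {s : List κ} {i : ℕ} (hs : ∀ k ∈ s, P i k) :
    ∀ k ∈ ws.foldl (entrywise g) s, P (i + ws.length) k := by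
  induction ws generalizing s i with
  | nil => simpa using hs
  | cons w ws ih =>
    have h1 := ih (fun i k w' hw' => hg i k w' (by simp [hw'])) (s := entrywise g s w) (i := i + 1)
      fun k hk => by
        obtain ⟨p, hp, rfl⟩ := List.mem_map.1 hk
        obtain ⟨h2, h3⟩ := List.of_mem_zip hp
        exact hg i _ w (by simp) _ h3 (hs _ h2)
    rw [List.length_cons, show i + (ws.length + 1) = i + 1 + ws.length by omega]
    exact h1

/-! #### Ranking by the maximum -/

/-- The maximum of a key and a fraction, where a key is either `⊥` or a fraction. -/
def maxKey (k : Bool × Frac) (a : Frac) : Bool × Frac :=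
  bif !k.1 || k.2.ltb a then (true, a) else k

/-- The value of a key. -/
def keyVal (k : Bool × Frac) : WithBot ℚ := bif k.1 then (k.2.val : WithBot ℚ) else ⊥

/-- Comparison of keys. -/
def keyLt (k k' : Bool × Frac) : Bool := k'.1 && (!k.1 || k.2.ltb k'.2)

theorem keyLt_iff (k k' : Bool × Frac) : keyLt k k' = true ↔ keyVal k < keyVal k' := by
  obtain ⟨_ | _, q⟩ := k <;> obtain ⟨_ | _, q'⟩ := k' <;> simp [keyLt, keyVal, Frac.ltb_iff]

theorem keyVal_maxKey (k : Bool × Frac) (a : Frac) :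
    keyVal (maxKey k a) = max (keyVal k) a.val := by
  obtain ⟨_ | _, q⟩ := k
  · simp [maxKey, keyVal]
  · rcases h : q.ltb a
    · have : ¬q.val < a.val := fun h' => by simp [(Frac.ltb_iff q a).2 h'] at h
      simp only [maxKey, keyVal, h, Bool.not_true, Bool.or_false, cond_false, cond_true]
      rw [max_eq_left]
      exact_mod_cast not_lt.1 this
    · have := (Frac.ltb_iff q a).1 h
      simp only [maxKey, keyVal, h, Bool.or_true, cond_true]
      rw [max_eq_right]
      exact_mod_cast this.le

/-- Both sides have the same upper bounds. -/
theorem keyVal_foldl_maxKey {m : ℕ} (x : Fin m → Frac) :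
    keyVal ((List.ofFn x).foldl maxKey (false, .ofInt 0)) = maxScore fun j => (x j).val := by
  have h : ∀ (l : List Frac) (k : Bool × Frac) (b : WithBot ℚ),
      keyVal (l.foldl maxKey k) ≤ b ↔ keyVal k ≤ b ∧ ∀ a ∈ l, (a.val : WithBot ℚ) ≤ b := by
    intro l
    induction l with
    | nil => simp
    | cons a l ih => intro k b; rw [List.foldl_cons, ih, keyVal_maxKey]; simp [and_assoc]
  refine eq_of_forall_ge_iff fun b => ?_
  rw [h, maxScore, Finset.sup_le_iff]
  simp [keyVal]

theorem polyTime_keyLt : PolyTime fun y : (Bool × Frac) × (Bool × Frac) => keyLt y.1 y.2 := by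
  change PolyTime fun y : (Bool × Frac) × (Bool × Frac) =>
    y.2.1 && (!y.1.1 || y.1.2.ltb y.2.2)
  fun_prop

/-- The increasing and the decreasing ranking share the same states, the running maxima of the rows,
and differ only in the final comparison `lt`. -/
theorem expPolyTime_of_max {K : Type} [LinearOrder K] {r : Ranking}
    {lt : Bool × Frac → Bool × Frac → Bool}
    (hlt : PolyTime fun y : (Bool × Frac) × (Bool × Frac) => lt y.1 y.2) {v : Bool × Frac → K}
    (hv : ∀ a b, lt a b = true ↔ v a < v b)
    (hr : ∀ (n m : ℕ) (A : Matrix (Fin n) (Fin m) Frac),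
      rankBy (fun i => v ((List.ofFn fun j => A i j).foldl maxKey (false, .ofInt 0))) =
        r n m (A.map Frac.val))
    {e : Effect} (he : PolyTimeEffect e) (c : ℕ) :
    ExpPolyTime binaryRat r e fun n _ => n ≤ c := by
  have hg : PolyTime fun y : (Bool × Frac) × Frac => maxKey y.1 y.2 := by
    change PolyTime fun y : (Bool × Frac) × Frac =>
      bif !y.1.1 || y.1.2.ltb y.2 then (true, y.2) else y.1
    fun_prop
  have hφ : PolyTime (id : Frac → Frac) := by exact PolyTime.id'
  have hacts := Input.polyTime_actions (F := binaryRat) (S := fun n _ => n ≤ c) (φ := id) hφ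
  have hent : PolyTime fun x : Input binaryRat fun n _ => n ≤ c =>
      ((x.actions id).flatten.map fun t => t.1).flatten := by fun_prop
  refine expPolyTime_of_keys (F := binaryRat) (φ := id) hφ (fun _ => rfl) he c
    (step := entrywise maxKey) (k₀ := (false, .ofInt 0)) (polyTime_entrywise hg)
    (polyBdd_foldl_entrywise _ csize 5 (fun k => by omega) fun k a => ?_) hlt hv
    (fun n m A => ⟨_, by rw [replicate_eq_ofFn, foldl_entrywise], hr n m A⟩)
    (length_entrywise _)
    (N := fun x => csize ((x.actions id).flatten.map fun t => t.1).flatten + 1)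
    (hent.polyBdd.add (.const 1)) fun x => ?_
  -- A replaced key has size `csize a + 4`, which is at most `5 * csize a`; hence the constant `5`.
  · have h1 : csize (true, a) = 3 + csize a + 1 := rfl
    have h2 := one_le_csize a
    rw [maxKey]
    cases !k.1 || k.2.ltb a
    · simp
    · simp only [cond_true]; omega
  -- A key is the initial one or carries an entry of a scaled column, exactly as represented there.
  -- Different representations of the same value are counted separately, which the bound permits.
  · refine ⟨insert (false, .ofInt 0)
      ((((x.actions id).flatten.map fun t => t.1).flatten).toFinset.image fun a => (true, a)),
      ?_, fun ws _ hws => ?_⟩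
    · refine (Finset.card_insert_le _ _).trans (Nat.succ_le_succ ?_)
      exact Finset.card_image_le.trans ((List.toFinset_card_le _).trans (length_le_csize _))
    · refine foldl_entrywise_induction (i := 0) (P := fun _ k => k ∈ _) ?_ (by simp)
      intro _ k w hw a ha hk
      rw [maxKey]
      cases !k.1 || k.2.ltb a
      · exact hk
      · refine Finset.mem_insert_of_mem (Finset.mem_image_of_mem _ ?_)
        obtain ⟨A, hA, hwA⟩ := hws w hw
        obtain ⟨t, ht, rfl⟩ := List.mem_map.1 hwA
        exact List.mem_toFinset.2 (List.mem_flatten.2 ⟨_, List.mem_map_of_mem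
          (List.mem_flatten.2 ⟨A, hA, ht⟩), ha⟩)

theorem expPolyTime_maxAsc {e : Effect} (he : PolyTimeEffect e) (c : ℕ) :
    ExpPolyTime binaryRat maxAsc e fun n _ => n ≤ c :=
  expPolyTime_of_max polyTime_keyLt keyLt_iff
    (fun n m A => by simp only [keyVal_foldl_maxKey]; rfl) he c

theorem expPolyTime_maxDsc {e : Effect} (he : PolyTimeEffect e) (c : ℕ) :
    ExpPolyTime binaryRat maxDsc e fun n _ => n ≤ c :=
  expPolyTime_of_max (lt := fun a b => keyLt b a) (v := fun k => OrderDual.toDual (keyVal k))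
    (polyTime_keyLt.comp (f := fun y : (Bool × Frac) × (Bool × Frac) => (y.2, y.1)) (by fun_prop))
    (fun a b => by rw [keyLt_iff, OrderDual.toDual_lt_toDual])
    (fun n m A => by simp only [keyVal_foldl_maxKey]; rfl) he c

/-! #### Ranking by the sum -/

/-- This is where the unary encoding enters: not only the digits, but the numbers themselves are
bounded by the input size. -/
theorem natAbs_le_csize_unaryInt (z : unaryInt.Rep) : Int.natAbs z ≤ csize z := by
  have h : csize (List.replicate (Int.natAbs z) false) ≤ csize z := by
    change csize (List.replicate (Int.natAbs z) false) ≤ (encBool _).size + _ + 1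
    exact (Nat.le_add_left _ _).trans (Nat.le_succ _)
  simpa using (length_le_csize _).trans h

theorem eq_signed (z : ℤ) : z = signed (decide (z < 0)) z.natAbs := by
  by_cases h : z < 0 <;> simp [signed, h, -Nat.cast_natAbs] <;> omega

theorem polyTime_ofUnary : PolyTime fun z : unaryInt.Rep => Frac.ofInt z := by
  have h1 : PolyTime fun z : unaryInt.Rep =>
      ((fun z : ℤ => (decide (z < 0), List.replicate z.natAbs false)) z) :=
    PolyTime.of_code_eq fun _ => rfl
  refine (h1.fst.signed h1.snd.length).fracOfInt.congr_code fun z => ?_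
  congr 2
  rw [List.length_replicate]
  exact eq_signed z

/-- There are at most `csize x` columns, and each contributes a product of two integers of absolute
value at most `csize x`. Partial sums thus lie in an interval `[-B, B]` with `2 * B + 1` integers.
-/
theorem expPolyTime_sumAsc {e : Effect} (he : PolyTimeEffect e) (c : ℕ) :
    ExpPolyTime unaryInt sumAsc e fun n _ => n ≤ c := by
  refine expPolyTime_of_keys (F := unaryInt) (φ := fun z => Frac.ofInt z) (r := sumAsc)
    polyTime_ofUnary Frac.val_ofInt he c
    (step := entrywise Frac.add) (k₀ := .ofInt 0) (polyTime_entrywise (by fun_prop))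
    (polyBdd_foldl_entrywise _ Frac.digits 11 csize_frac_le fun k a => ?_)
    (lt := Frac.ltb) (by fun_prop) (v := Frac.val) Frac.ltb_iff
    (fun n m A => ⟨_, by rw [replicate_eq_ofFn, foldl_entrywise], ?_⟩)
    (length_entrywise _) (N := fun x => 2 * (csize x * (csize x * csize x)) + 1)
    (((PolyBdd.const 2).mul (PolyBdd.csize_self.mul
      (PolyBdd.csize_self.mul PolyBdd.csize_self))).add (.const 1)) fun x => ?_
  · have h1 := Frac.digits_add_le k a
    have h2 := digits_le_csize a
    have h3 := one_le_csize a
    omega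
  · have : ∀ i, (Frac.val <| (List.ofFn fun j => A i j).foldl Frac.add (.ofInt 0)) =
        ∑ j, A.map Frac.val i j := fun i => by
      have := Frac.val_sum (List.ofFn fun j => A i j)
      rw [Frac.sum] at this
      rw [this, List.map_ofFn, List.sum_ofFn]
      rfl
    simp only [this]
    rfl
  · have hx : csize x = csize (rowList x.mat) + (csize x.pairs + csize x.par + 1) + 1 := by
      rw [csize, Input.code_eq]; rfl
    let B : ℕ := csize x * (csize x * csize x)
    refine ⟨(Finset.Icc (-(B : ℤ)) B).image Frac.ofInt, ?_, fun ws hlen hws => ?_⟩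
    · refine Finset.card_image_le.trans ?_
      rw [Int.card_Icc]
      omega
    -- Sums and products of fractions with denominator `1` again have denominator exactly `1`. So
    -- equal partial sums are equal as fractions, and counting integers counts keys.
    · have key := foldl_entrywise_induction (ws := ws) (g := Frac.add) (i := 0)
        (s := List.replicate x.n (.ofInt 0))
        (P := fun i k => ∃ z : ℤ, k = .ofInt z ∧ z.natAbs ≤ i * (csize x * csize x)) ?_ ?_
      · intro k hk
        obtain ⟨z, rfl, hz⟩ := key k hk
        refine Finset.mem_image_of_mem _ (Finset.mem_Icc.2 ?_)
        have h1 : x.m ≤ csize x := by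
          have h2 := length_le_csize x.pairs
          rw [Input.pairs, List.length_ofFn] at h2
          rw [hx, Input.pairs]
          omega
        have h2 : z.natAbs ≤ B := hz.trans (Nat.mul_le_mul_right _ (by omega))
        omega
      · rintro i k w hw a ha ⟨z, rfl, hz⟩
        obtain ⟨A, hA, hwA⟩ := hws w hw
        obtain ⟨j, hj, rfl⟩ := List.mem_iff_getElem.1 hA
        obtain ⟨p, hp, rfl⟩ := Input.isScaledColumn_of_mem _ hj hwA
        obtain ⟨i', rfl⟩ := List.mem_ofFn.1 ha
        generalize (⟨j, _⟩ : Fin x.m) = j at *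
        have h1 : Int.natAbs (x.mat i' j) ≤ csize x := by
          refine (natAbs_le_csize_unaryInt _).trans ?_
          have h2 : x.mat i' j ∈ List.ofFn fun j => x.mat i' j := List.mem_ofFn.2 ⟨j, rfl⟩
          have h3 : (List.ofFn fun j => x.mat i' j) ∈ rowList x.mat := List.mem_ofFn.2 ⟨i', rfl⟩
          have h4 := csize_mem_le h2
          have h5 := csize_mem_le h3
          omega
        have h2 : Int.natAbs p.1 ≤ csize x := by
          refine (natAbs_le_csize_unaryInt _).trans ?_
          have h3 : (x.dist j).pairs ∈ x.pairs := List.mem_ofFn.2 ⟨j, rfl⟩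
          have h4 := csize_mem_le hp
          have h5 := csize_mem_le h3
          have h6 : csize p = csize p.1 + csize p.2 + 1 := rfl
          omega
        generalize x.mat i' j = a, p.1 = b at h1 h2 ⊢
        change ℤ at a b
        refine ⟨z + a * b, ?_, ?_⟩
        · simp [Frac.add, Frac.mul, Frac.ofInt]
        · refine (Int.natAbs_add_le _ _).trans ?_
          rw [Int.natAbs_mul, add_mul, one_mul]
          exact Nat.add_le_add hz (Nat.mul_le_mul h1 h2)
      · intro k hk
        exact ⟨0, (List.eq_of_mem_replicate hk), by simp⟩

/-! #### Ranking by the lexicographic order -/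

/-- The update of the levels of the rows, where the level of a row is the number of the rows that
are lexicographically smaller as far as the columns have been read. -/
def lexStep (s : List ℕ) (w : List Frac) : List ℕ :=
  (s.zip w).map fun p =>
    ((s.zip w).filter fun q => decide (q.1 < p.1) || (decide (q.1 = p.1) && q.2.ltb p.2)).length

/-- The first difference is either before the last entry or at it. This form fits columns read from
left to right. -/
theorem toLex_snoc_lt_iff {m : ℕ} (x y : Fin (m + 1) → ℚ) :
    toLex x < toLex y ↔ toLex (fun j : Fin m => x j.castSucc) < toLex (fun j => y j.castSucc) ∨
      ((fun j : Fin m => x j.castSucc) = (fun j => y j.castSucc) ∧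
        x (Fin.last m) < y (Fin.last m)) := by
  constructor
  · rintro ⟨i, h1, h2⟩
    induction i using Fin.lastCases with
    | last => exact Or.inr ⟨funext fun j => h1 _ (Fin.castSucc_lt_last j), h2⟩
    | cast i => exact Or.inl ⟨i, fun j hj => h1 _ (Fin.castSucc_lt_castSucc_iff.2 hj), h2⟩
  · rintro (⟨i, h1, h2⟩ | ⟨h1, h2⟩)
    · refine ⟨i.castSucc, fun j hj => ?_, h2⟩
      induction j using Fin.lastCases with
      | last => exact absurd hj (Fin.castSucc_lt_last i).not_gt
      | cast j => exact h1 j (Fin.castSucc_lt_castSucc_iff.1 hj)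
    · refine ⟨Fin.last m, fun j hj => ?_, h2⟩
      induction j using Fin.lastCases with
      | last => exact absurd hj (lt_irrefl _)
      | cast j => exact congrFun h1 j

/-- Replacing each key by the number of smaller keys preserves their order and compresses the keys
to small numbers. -/
theorem card_filter_lt_lt_iff {K : Type} [LinearOrder K] {n : ℕ} (k : Fin n → K) (i j : Fin n) :
    (Finset.univ.filter fun l => k l < k i).card < (Finset.univ.filter fun l => k l < k j).card ↔
      k i < k j := by
  constructor
  · intro h
    by_contra h'
    refine h.not_ge (Finset.card_le_card fun l hl => ?_)
    simp only [Finset.mem_filter, Finset.mem_univ, true_and] at hl ⊢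
    exact hl.trans_le (not_lt.1 h')
  · intro h
    refine Finset.card_lt_card (Finset.ssubset_iff_of_subset ?_ |>.2 ⟨i, by simpa using h, by simp⟩)
    intro l hl
    simp only [Finset.mem_filter, Finset.mem_univ, true_and] at hl ⊢
    exact hl.trans h

/-- Levels order the rows, ties included, as their prefixes do. A new column only refines ties, so
the old levels and the new entries determine the new levels. -/
theorem exists_levels {n m : ℕ} (A : Matrix (Fin n) (Fin m) Frac) :
    ∃ k : Fin n → ℕ, (colList A).foldl lexStep (List.replicate n 0) = List.ofFn k ∧
      ∀ i i', k i < k i' ↔ (toLex fun j => (A i j).val) < toLex fun j => (A i' j).val := by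
  induction m with
  | zero =>
    refine ⟨fun _ => 0, by rw [replicate_eq_ofFn]; rfl, fun i i' => ?_⟩
    simp only [lt_irrefl, false_iff]
    rintro ⟨j, -⟩
    exact j.elim0
  | succ m ih =>
    obtain ⟨k, hk, h⟩ := ih (Matrix.of fun i j => A i (Fin.castSucc j))
    have hcol : colList A = colList (Matrix.of fun i j => A i (Fin.castSucc j)) ++
        [List.ofFn fun i => A i (Fin.last m)] := by
      rw [colList, List.ofFn_succ', List.concat_eq_append]; rfl
    have heq : ∀ i i', k i = k i' ↔
        (fun j : Fin m => (A i j.castSucc).val) = fun j => (A i' j.castSucc).val := fun i i' =>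
      (eq_iff_eq_of_lt_iff_lt h i i').trans (toLex (α := Fin m → ℚ)).injective.eq_iff
    -- By induction, comparing extended prefixes amounts to comparing these pairs lexicographically;
    -- `lexStep` compresses the pairs to counts.
    let f : Fin n → ℕ ×ₗ ℚ := fun i => toLex (k i, (A i (Fin.last m)).val)
    refine ⟨fun i => (Finset.univ.filter fun l => f l < f i).card, ?_, fun i i' => ?_⟩
    · rw [hcol, List.foldl_append, hk, List.foldl_cons, List.foldl_nil, lexStep, zip_ofFn,
        List.map_ofFn]
      congr 1
      ext1 i
      rw [Function.comp, length_filter_ofFn]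
      simp only [Bool.or_eq_true, Bool.and_eq_true, decide_eq_true_eq, Frac.ltb_iff, f,
        Prod.Lex.toLex_lt_toLex]
    · rw [card_filter_lt_lt_iff, toLex_snoc_lt_iff, Prod.Lex.toLex_lt_toLex, h, heq]
      rfl

/-- A level depends on all rows at once, so the step is not entrywise. There are only `c + 1`
possible levels, regardless of the numbers in the input. -/
theorem expPolyTime_lexRank {e : Effect} (he : PolyTimeEffect e) (c : ℕ) :
    ExpPolyTime binaryRat lexRank e fun n _ => n ≤ c := by
  have : Inhabited Frac := ⟨.ofInt 0⟩
  have hstep : PolyTime fun y : List ℕ × List Frac => lexStep y.1 y.2 := by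
    change PolyTime fun y : List ℕ × List Frac => (y.1.zip y.2).map fun p =>
      ((y.1.zip y.2).filter fun q =>
        decide (q.1 < p.1) || (decide (q.1 = p.1) && q.2.ltb p.2)).length
    fun_prop
  -- Each new level counts elements of the zipped list, which is no longer than the state.
  have hbound : ∀ (n : ℕ) (ws : List (List Frac)) (s : List ℕ), s.length ≤ n → (∀ k ∈ s, k ≤ n) →
      (ws.foldl lexStep s).length ≤ n ∧ ∀ k ∈ ws.foldl lexStep s, k ≤ n := by
    intro n ws
    induction ws with
    | nil => exact fun s h1 h2 => ⟨h1, h2⟩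
    | cons w ws ih =>
      intro s h1 h2
      have h3 : (s.zip w).length ≤ n := by rw [List.length_zip]; omega
      refine ih _ (by rwa [lexStep, List.length_map]) fun k hk => ?_
      obtain ⟨p, -, rfl⟩ := List.mem_map.1 hk
      exact (List.length_filter_le _ _).trans h3
  have hφ : PolyTime (id : Frac → Frac) := by exact PolyTime.id'
  refine expPolyTime_of_keys (F := binaryRat) (φ := id) hφ (fun _ => rfl) he c
    (step := lexStep) (k₀ := 0) hstep ?_ (lt := fun a b => decide (a < b)) (by fun_prop)
    (v := fun k : ℕ => k) (fun a b => by simp)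
    (fun n m A => ?_) (fun s w h => by simp [lexStep, h])
    (N := fun _ => c + 1) (.const _) fun x => ?_
  · have hfst : PolyTime fun y : List Unit × List (List Frac) => y.1 := by fun_prop
    refine PolyBdd.of_le (h := fun y => csize y.1 * ((4 * csize y.1 + 1) + 1) + 1)
      ((hfst.polyBdd.mul ((((PolyBdd.const 4).mul hfst.polyBdd).add (.const 1)).add
        (.const 1))).add (.const 1)) fun y => ?_
    have h1 := length_le_csize y.1
    obtain ⟨h2, h3⟩ := hbound (csize y.1) y.2 (List.replicate y.1.length 0)
      (by rwa [List.length_replicate]) fun k hk => by simp [List.eq_of_mem_replicate hk]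
    refine csize_list_le h2 fun k hk => ?_
    have h4 := csize_nat_le k
    have h5 : k.size ≤ k := Nat.size_le.2 Nat.lt_two_pow_self
    have h6 := h3 k hk
    omega
  · obtain ⟨k, hk, h⟩ := exists_levels A
    exact ⟨k, hk, rankBy_congr h⟩
  · refine ⟨Finset.range (c + 1), by simp, fun ws _ _ k hk => ?_⟩
    have := (hbound c ws (List.replicate x.n 0) (by simpa using x.dim)
      fun k hk => by simp [List.eq_of_mem_replicate hk]).2 k hk
    exact Finset.mem_range.2 (by omega)

end ExpEffect

theorem mainTheorem8 :
    (∀ (r : ExpEffect.Ranking) (e : ExpEffect.Effect),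
      ExpEffect.PolyTimeRanking r → ExpEffect.PolyTimeEffect e →
      ∀ c : ℕ, ExpEffect.ExpPolyTime ExpEffect.binaryRat r e (fun _ m => m ≤ c)) ∧
    (∀ e : ExpEffect.Effect, ExpEffect.PolyTimeEffect e →
      ∀ c : ℕ,
        ExpEffect.ExpPolyTime ExpEffect.binaryRat ExpEffect.maxAsc e (fun n _ => n ≤ c) ∧
        ExpEffect.ExpPolyTime ExpEffect.binaryRat ExpEffect.maxDsc e (fun n _ => n ≤ c) ∧
        ExpEffect.ExpPolyTime ExpEffect.binaryRat ExpEffect.lexRank e (fun n _ => n ≤ c) ∧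
        ExpEffect.ExpPolyTime ExpEffect.unaryInt ExpEffect.sumAsc e (fun n _ => n ≤ c)) :=
  ⟨fun _ _ hr he c => ExpEffect.expPolyTime_of_cols_le hr he c,
    fun _ he c => ⟨ExpEffect.expPolyTime_maxAsc he c, ExpEffect.expPolyTime_maxDsc he c,
      ExpEffect.expPolyTime_lexRank he c, ExpEffect.expPolyTime_sumAsc he c⟩⟩
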